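/- Let $\mathbb O$ be the octonions with imaginary units $e_1,\dots,e_7$, multiplied so that $e_ie_j=e_k$ (cyclically in $i,j,k$) for $(i,j,k)=(1,5,2),(1,6,3),(1,7,4),(2,7,3),(2,4,6),(3,5,4),(5,6,7)$, distinct units anticommute and $e_i^2=-1$. Identify $\mathbb C^7=\operatorname{Im}(\mathbb O)\otimes\mathbb C$, with conjugation $v\mapsto\bar v$, the complex bilinear form $\langle x,y\rangle=\sum_i x_iy_i$, orthogonal complements $\perp$ taken with respect to it, and $x\cdot y\in\mathbb C^7$ the imaginary part of the octonionic product. Let $\mathbb G_2\subset SO(7,\mathbb C)$ be the automorphism group of $\mathbb O\otimes\mathbb C$ acting on $\mathbb C^7$. A subspace is isotropic if $\langle\cdot,\cdot\rangle$ vanishes on it; a complex coassociative plane is an isotropic $2$-plane $\mathcal C\subset\mathbb C^7$ with $\mathcal C\cdot\mathcal C=0$. Let $\mathcal L_-^\tau(\mathbb G_2,\mathbb C^7)$ be the group of functions $g$ that are holomorphic with values in $\mathbb G_2$ on an open dense subset of $\mathbb{CP}^1$, meromorphic on $\mathbb{CP}^1$ as $\operatorname{End}(\mathbb C^7)$-valued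 functions, satisfy $\overline{g(\bar\lambda)}=g(\lambda)$, and are holomorphic at $\infty$ with $g(\infty)=\mathrm{Id}$; functions that agree on an open dense set are identified. For $\alpha\in\mathbb C\setminus\mathbb R$ and an isotropic subspace $W\subset\mathbb C^7$ put \[ p_{\alpha,W}(\lambda)=\frac{\lambda-\bar\alpha}{\lambda-\alpha}\,\pi_{\overline W}+\pi_{(W\oplus\overline W)^\perp}+\frac{\lambda-\alpha}{\lambda-\bar\alpha}\,\pi_W , \] where $\pi_U$ is the Hermitian orthogonal projection onto $U$. Fix $\alpha\in\mathbb C\setminus\mathbb R$. For isotropic lines $L,K\subset\mathbb C^7$ consider the condition \[ (*)\qquad K\subset\overline L^{\perp}\quad\text{and}\quad \mathcal C=L\oplus\pi_{(L\oplus\overline L)^\perp}K\ \text{ is a complex coassociative plane.} \] (1) If $L,K$ are isotropic lines with $K\neq\overline L$, then $(*)$ holds if and only if $p_{\alpha,L}\,p_{\alpha,K}\in\mathcal L_-^\tau(\mathbb G_2,\mathbb C^7)$. (2) If $L,K$ are isotropic lines satisfying $(*)$, then $p_{\alpha,L}\,p_{\alpha,K}$ has simple poles at $\alpha$ and $\bar\alpha$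 and no other poles. (3) Let $g\in\mathcal L_-^\tau(\mathbb G_2,\mathbb C^7)$ have simple poles at $\alpha$ and $\bar\alpha$ and no other poles. Then $g=p_{\alpha,L}\,p_{\alpha,K}$ for some isotropic lines $L,K$ satisfying $(*)$. Moreover, for every factorization $g=p_{\alpha,L}\,p_{\alpha,K}$ with isotropic lines $L,K$: if $K\subset(L\oplus\overline L)^\perp$, then $L\oplus\pi_{(L\oplus\overline L)^\perp}K=L\oplus K$ is complex coassociative and $g=p_{\alpha,L\oplus K}$; and if $K\not\subset(L\oplus\overline L)^\perp$, then there is an isotropic line $R$ such that $\mathcal C_1=L\oplus R$ and $\mathcal C_2=\overline R\oplus K$ are complex coassociative and $g=p_{\alpha,\mathcal C_1}\,p_{\alpha,\mathcal C_2}$. -/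

import Mathlib

open Filter Topology

noncomputable section

namespace G2Loop

/-- `ℂ⁷ = Im 𝕆 ⊗ ℂ` with its standard Hermitian inner product. The index `i : Fin 7` stands for
the imaginary unit `e_{i+1}`. -/
abbrev V : Type := EuclideanSpace ℂ (Fin 7)

/-- The complex bilinear extension of the standard inner product of `ℝ⁷`. -/
def dot (x y : V) : ℂ := ∑ i, x i * y i

/-- The imaginary part of the product of two imaginary (complexified) octonions, for the
multiplication table of `e₁, …, e₇` in which `e_i e_j = e_k`, cyclically in `(i, j, k)`, for
`(1,5,2), (1,6,3), (1,7,4), (2,7,3), (2,4,6), (3,5,4), (5,6,7)`. -/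
def imMul (x y : V) : V :=
  !₂[(x 4 * y 1 - x 1 * y 4) + (x 5 * y 2 - x 2 * y 5) + (x 6 * y 3 - x 3 * y 6),
     (x 0 * y 4 - x 4 * y 0) + (x 6 * y 2 - x 2 * y 6) + (x 3 * y 5 - x 5 * y 3),
     (x 0 * y 5 - x 5 * y 0) + (x 1 * y 6 - x 6 * y 1) + (x 4 * y 3 - x 3 * y 4),
     (x 0 * y 6 - x 6 * y 0) + (x 5 * y 1 - x 1 * y 5) + (x 2 * y 4 - x 4 * y 2),
     (x 1 * y 0 - x 0 * y 1) + (x 3 * y 2 - x 2 * y 3) + (x 5 * y 6 - x 6 * y 5),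
     (x 2 * y 0 - x 0 * y 2) + (x 1 * y 3 - x 3 * y 1) + (x 6 * y 4 - x 4 * y 6),
     (x 3 * y 0 - x 0 * y 3) + (x 2 * y 1 - x 1 * y 2) + (x 4 * y 5 - x 5 * y 4)]

/-- The product of the complexified octonions `𝕆 ⊗ ℂ = ℂ·1 ⊕ Im 𝕆 ⊗ ℂ`. -/
def octMul (p q : ℂ × V) : ℂ × V :=
  (p.1 * q.1 - dot p.2 q.2, p.1 • q.2 + q.1 • p.2 + imMul p.2 q.2)

/-- The operator `A` of `ℂ⁷` belongs to the complex group `𝔾₂`: it is the restriction to the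
imaginary part of an automorphism of the complex algebra `𝕆 ⊗ ℂ`. -/
def InG2 (A : V →L[ℂ] V) : Prop :=
  ∃ φ : (ℂ × V) ≃ₗ[ℂ] (ℂ × V),
    (∀ p q, φ (octMul p q) = octMul (φ p) (φ q)) ∧ ∀ v, φ (0, v) = (0, A v)

/-- Complex conjugation on `ℂ⁷`. -/
def conjV (x : V) : V := WithLp.toLp 2 fun i => (starRingEnd ℂ) (x i)

/-- The complex conjugate `W̄` of a subspace `W` of `ℂ⁷`. -/
def conjSub (W : Submodule ℂ V) : Submodule ℂ V where
  carrier := {x | conjV x ∈ W}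
  zero_mem' := by
    have h : conjV 0 = 0 := by ext i; simp [conjV]
    simp [h]
  add_mem' := by
    intro a b ha hb
    have h : conjV (a + b) = conjV a + conjV b := by ext i; simp [conjV]
    simpa [h] using W.add_mem ha hb
  smul_mem' := by
    intro c a ha
    have h : conjV (c • a) = (starRingEnd ℂ c) • conjV a := by ext i; simp [conjV]
    simpa [h] using W.smul_mem (starRingEnd ℂ c) ha

/-- The orthogonal `W^⊥` with respect to the complex bilinear form `dot`. -/
def perp (W : Submodule ℂ V) : Submodule ℂ V where
  carrier := {x | ∀ y ∈ W, dot x y = 0}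
  zero_mem' := by intro y _; simp [dot]
  add_mem' := by
    intro a b ha hb y hy
    have h : dot (a + b) y = dot a y + dot b y := by
      simp [dot, add_mul, Finset.sum_add_distrib]
    rw [h, ha y hy, hb y hy, add_zero]
  smul_mem' := by
    intro c a ha y hy
    have h : dot (c • a) y = c * dot a y := by simp [dot, Finset.mul_sum, mul_assoc]
    rw [h, ha y hy, mul_zero]

/-- `W` is isotropic for the complex bilinear form. -/
def IsIsotropic (W : Submodule ℂ V) : Prop := ∀ x ∈ W, ∀ y ∈ W, dot x y = 0

/-- Isotropic complex lines in `ℂ⁷`. -/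
def IsIsotropicLine (L : Submodule ℂ V) : Prop := Module.finrank ℂ L = 1 ∧ IsIsotropic L

/-- Complex coassociative planes: isotropic 2-planes `C` with `C · C = 0`. -/
def IsCoassociative (C : Submodule ℂ V) : Prop :=
  Module.finrank ℂ C = 2 ∧ IsIsotropic C ∧ ∀ x ∈ C, ∀ y ∈ C, imMul x y = 0

/-- The simple factor `p_{α,W}` attached to an isotropic subspace `W` (a line or a complex
coassociative plane):
`p_{α,W}(z) = (z-ᾱ)/(z-α) π_{W̄} + π_{(W⊕W̄)^⊥} + (z-α)/(z-ᾱ) π_W`, where the `π` are the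
Hermitian orthogonal projections. Its values at `α` and `ᾱ` are irrelevant. -/
def simpleFactor (α : ℂ) (W : Submodule ℂ V) (z : ℂ) : V →L[ℂ] V :=
  ((z - (starRingEnd ℂ) α) / (z - α)) • (conjSub W).starProjection
    + (perp (W ⊔ conjSub W)).starProjection
    + ((z - α) / (z - (starRingEnd ℂ) α)) • W.starProjection

/-- Two loops are identified when they agree on an open dense set. -/
def LoopEq (f g : ℂ → V →L[ℂ] V) : Prop :=
  ∃ U : Set ℂ, IsOpen U ∧ Dense U ∧ ∀ z ∈ U, f z = g z

/-- `g` represents an element of the rational loop group of `𝔾₂` on `ℂ⁷`: it is holomorphic with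
values in `𝔾₂` on an open dense set, and it is meromorphic on the Riemann sphere (at `∞` through
the coordinate `1/z`). -/
structure IsRationalG2Loop (g : ℂ → V →L[ℂ] V) : Prop where
  groupValued : ∃ U : Set ℂ, IsOpen U ∧ Dense U ∧ DifferentiableOn ℂ g U ∧ ∀ z ∈ U, InG2 (g z)
  meromorphic : ∀ z, MeromorphicAt g z
  meromorphic_infty : MeromorphicAt (fun w => g w⁻¹) 0

/-- `g` represents an element of the group `𝓛₋^τ(𝔾₂, ℂ⁷)` of rational loops that satisfy the
reality condition `τ(g(z̄)) = g(z)`, for `τ(A) = Ā`, and are holomorphic at `∞` with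
`g(∞) = Id`. -/
structure IsNegRealG2Loop (g : ℂ → V →L[ℂ] V) : Prop extends IsRationalG2Loop g where
  reality : ∃ U : Set ℂ, IsOpen U ∧ Dense U ∧
    ∀ z ∈ U, ∀ v, conjV (g ((starRingEnd ℂ) z) (conjV v)) = g z v
  negative : ∃ h : ℂ → V →L[ℂ] V, AnalyticAt ℂ h 0 ∧ h 0 = ContinuousLinearMap.id ℂ V ∧
    ∀ᶠ w in 𝓝[≠] (0 : ℂ), g w⁻¹ = h w

/-- `g` has simple poles at `α` and at `ᾱ`, and no other pole in `ℂ`. -/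
def OnlySimplePoles (g : ℂ → V →L[ℂ] V) (α : ℂ) : Prop :=
  meromorphicOrderAt g α = -1 ∧ meromorphicOrderAt g ((starRingEnd ℂ) α) = -1 ∧
    ∀ z, z ≠ α → z ≠ (starRingEnd ℂ) α → 0 ≤ meromorphicOrderAt g z

/-- `L + π_{(L⊕L̄)^⊥} K`. -/
def pairPlane (L K : Submodule ℂ V) : Submodule ℂ V :=
  L ⊔ K.map ((perp (L ⊔ conjSub L)).starProjection : V →ₗ[ℂ] V)

/-- The condition on a pair of lines: `K ⊂ L̄^⊥`, and `L ⊕ π_{(L⊕L̄)^⊥} K` is complex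
coassociative (in particular of dimension two). -/
def PairCondition (L K : Submodule ℂ V) : Prop :=
  K ≤ perp (conjSub L) ∧ IsCoassociative (pairPlane L K)

end G2Loop

end

open Filter Topology

noncomputable section

namespace G2Loop

/-! ### The bilinear form, the cross product and conjugation -/

/-! Everything reduces to one vector. For a unit vector l of an isotropic line L put w = l · l̄.
Then ⟨w, w⟩ = -1, and ℂ⁷ is the sum of ℂw and the eigenspaces E₊, E₋ of right multiplication by w
for 1 and -1. Both are isotropic, l lies in E₊ and l̄ in E₋, the product maps E₊ × E₊ to E₋ and E₋ ×
E₋ to E₊, and on E₊ × E₋ it is the pairing times w. The simple factor of L is the `flow` that scales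
l by a and l̄ by a⁻¹. It is orthogonal, fixes w, preserves E₊ and E₋, and respects products of two
vectors of E₊ up to its determinant a on E₊. Two flows with the same w and inverse parameters
therefore compose to an element of 𝔾₂, inside the stabilizer SL(3) of w (`imMul_flow_flow`).
Conversely, the 1/z term at ∞ of a 𝔾₂-valued product of two factors is a derivation, which forces l
· l̄ = k̄ · k (`cross_eq_of_imMul_flow_flow`). For K ≠ L̄ this equation is exactly the condition on
the pair (`NullPair.pairCondition_iff`). This gives (1), and partial fractions give (2).

For (3), Liouville's theorem and the reality condition give g = 1 + A/(z-α) + Ā/(z-ᾱ)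
(`exists_eq_twoPole`, `exists_residue`). The range of A is isotropic with vanishing product, so its
dimension is at most two (`finrank_le_two`). Dividing by a suitable simple factor keeps this form
and enlarges the kernel of the residue (`exists_split`). One factor is never enough, since a single
simple factor is not 𝔾₂-valued (`NullPair.exists_not_inG2`); hence there are exactly two. The planes
arise by inserting the trivial product of the factors of R and R̄ between those of L and K, where R
is spanned by l · k̄ (`NullPair.exists_completing_line`). -/

lemma dot_comm (x y : V) : dot x y = dot y x := by
  simp only [dot, mul_comm]

@[simp] lemma dot_add_left (x y z : V) : dot (x + y) z = dot x z + dot y z := by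
  simp [dot, add_mul, Finset.sum_add_distrib]

@[simp] lemma dot_smul_left (c : ℂ) (x y : V) : dot (c • x) y = c * dot x y := by
  simp [dot, Finset.mul_sum, mul_assoc]

@[simp] lemma dot_add_right (x y z : V) : dot x (y + z) = dot x y + dot x z := by
  simp [dot, mul_add, Finset.sum_add_distrib]

@[simp] lemma dot_smul_right (c : ℂ) (x y : V) : dot x (c • y) = c * dot x y := by
  rw [dot_comm, dot_smul_left, dot_comm]

@[simp] lemma dot_zero_left (x : V) : dot 0 x = 0 := by simp [dot]

@[simp] lemma dot_zero_right (x : V) : dot x 0 = 0 := by simp [dot]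

@[simp] lemma dot_neg_left (x y : V) : dot (-x) y = -dot x y := by simp [dot]

@[simp] lemma dot_neg_right (x y : V) : dot x (-y) = -dot x y := by simp [dot]

@[simp] lemma dot_sub_left (x y z : V) : dot (x - y) z = dot x z - dot y z := by
  simp [sub_eq_add_neg]

@[simp] lemma dot_sub_right (x y z : V) : dot x (y - z) = dot x y - dot x z := by
  simp [sub_eq_add_neg]

@[simp] lemma imMul_add_left (x y z : V) : imMul (x + y) z = imMul x z + imMul y z := by
  ext i; fin_cases i <;> simp [imMul] <;> ring

@[simp] lemma imMul_add_right (x y z : V) : imMul x (y + z) = imMul x y + imMul x z := by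
  ext i; fin_cases i <;> simp [imMul] <;> ring

@[simp] lemma imMul_smul_left (c : ℂ) (x y : V) : imMul (c • x) y = c • imMul x y := by
  ext i; fin_cases i <;> simp [imMul] <;> ring

@[simp] lemma imMul_smul_right (c : ℂ) (x y : V) : imMul x (c • y) = c • imMul x y := by
  ext i; fin_cases i <;> simp [imMul] <;> ring

lemma imMul_anticomm (x y : V) : imMul x y = -imMul y x := by
  ext i; fin_cases i <;> simp [imMul] <;> ring

@[simp] lemma imMul_self (x : V) : imMul x x = 0 := by
  ext i; fin_cases i <;> simp [imMul] <;> ring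

@[simp] lemma imMul_zero_left (x : V) : imMul 0 x = 0 := by
  simpa using imMul_smul_left 0 0 x

@[simp] lemma imMul_zero_right (x : V) : imMul x 0 = 0 := by
  simpa using imMul_smul_right 0 x 0

@[simp] lemma imMul_neg_left (x y : V) : imMul (-x) y = -imMul x y := by
  simpa using imMul_smul_left (-1) x y

@[simp] lemma imMul_neg_right (x y : V) : imMul x (-y) = -imMul x y := by
  simpa using imMul_smul_right (-1) x y

@[simp] lemma imMul_sub_left (x y z : V) : imMul (x - y) z = imMul x z - imMul y z := by
  simp [sub_eq_add_neg]

@[simp] lemma imMul_sub_right (x y z : V) : imMul x (y - z) = imMul x y - imMul x z := by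
  simp [sub_eq_add_neg]

/-- The trilinear form `⟨x · y, z⟩` is cyclic. -/
lemma dot_imMul (x y z : V) : dot (imMul x y) z = dot x (imMul y z) := by
  simp [imMul, dot, Fin.sum_univ_succ]
  ring

/-- The alternative law for the imaginary part of the octonionic product, polarized. -/
lemma imMul_imMul_polarized (x y z : V) :
    imMul x (imMul y z) + imMul y (imMul x z) =
      dot x z • y + dot y z • x - (2 * dot x y) • z := by
  ext i
  fin_cases i <;> simp [imMul, dot, Fin.sum_univ_succ] <;> ring

lemma imMul_imMul_self (x y : V) : imMul x (imMul x y) = dot x y • x - dot x x • y := by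
  have h := imMul_imMul_polarized x x y
  have h2 : (2 : ℂ) • imMul x (imMul x y) = (2 : ℂ) • (dot x y • x - dot x x • y) := by
    linear_combination (norm := module) h
  exact smul_right_injective V (two_ne_zero : (2 : ℂ) ≠ 0) h2

@[simp] lemma conjV_conjV (x : V) : conjV (conjV x) = x := by ext i; simp [conjV]

@[simp] lemma conjV_add (x y : V) : conjV (x + y) = conjV x + conjV y := by ext i; simp [conjV]

@[simp] lemma conjV_sub (x y : V) : conjV (x - y) = conjV x - conjV y := by ext i; simp [conjV]

@[simp] lemma conjV_zero : conjV 0 = 0 := by ext i; simp [conjV]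

@[simp] lemma conjV_smul (c : ℂ) (x : V) :
    conjV (c • x) = (starRingEnd ℂ c) • conjV x := by ext i; simp [conjV]

@[simp] lemma conjV_eq_zero {x : V} : conjV x = 0 ↔ x = 0 := by
  constructor
  · intro h; rw [← conjV_conjV x, h, conjV_zero]
  · rintro rfl; exact conjV_zero

lemma dot_conjV_conjV (x y : V) : dot (conjV x) (conjV y) = starRingEnd ℂ (dot x y) := by
  simp [dot, conjV]

lemma imMul_conjV_conjV (x y : V) : imMul (conjV x) (conjV y) = conjV (imMul x y) := by
  ext i
  fin_cases i <;> simp [imMul, conjV]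

lemma inner_eq_dot (x y : V) : inner ℂ x y = dot (conjV x) y := by
  simp [PiLp.inner_apply, dot, conjV, mul_comm]

lemma dot_conjV_self_eq_zero {x : V} : dot (conjV x) x = 0 ↔ x = 0 := by
  rw [← inner_eq_dot, inner_self_eq_zero]

/-! ### Null pairs -/

/-- Two isotropic vectors with pairing `1`. -/
structure NullPair (l l' : V) : Prop where
  left : dot l l = 0
  right : dot l' l' = 0
  pairing : dot l l' = 1

namespace NullPair

variable {l l' m m' u v : V}

lemma symm (h : NullPair l l') : NullPair l' l :=
  ⟨h.right, h.left, by rw [dot_comm, h.pairing]⟩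

lemma pairing' (h : NullPair l l') : dot l' l = 1 := h.symm.pairing

lemma mul_cross_left (h : NullPair l l') : imMul l (imMul l l') = l := by
  rw [imMul_imMul_self, h.pairing, h.left]; simp

lemma mul_cross_right (h : NullPair l l') : imMul l' (imMul l l') = -l' := by
  rw [imMul_anticomm l l', imMul_neg_right, h.symm.mul_cross_left]

lemma dot_cross_left (l l' : V) : dot l (imMul l l') = 0 := by
  rw [← dot_imMul, imMul_self, dot_zero_left]

lemma dot_cross_right (l l' : V) : dot l' (imMul l l') = 0 := by
  rw [imMul_anticomm, dot_neg_right, dot_cross_left, neg_zero]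

lemma cross_dot_cross (h : NullPair l l') : dot (imMul l l') (imMul l l') = -1 := by
  rw [dot_imMul, h.mul_cross_right, dot_neg_right, h.pairing]

/-- Vectors of the `1`-eigenspace of right multiplication by a vector are mutually orthogonal. -/
lemma dot_eq_zero_of_eigen {w : V} (hu : imMul u w = u) (hv : imMul v w = v) : dot u v = 0 := by
  have h1 : dot u v = -dot u v := by
    conv_lhs => rw [← hu, dot_imMul, imMul_anticomm w v, hv, dot_neg_right]
  linear_combination (1 / 2 : ℂ) * h1

/-- The product of an eigenvector for `1` and one for `-1` of right multiplication by `w`. -/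
lemma imMul_eigen_opposite {w : V} (hu : imMul u w = u)
    (hv : imMul v w = -v) : imMul u v = dot u v • w := by
  have hwu : dot w u = 0 := by
    rw [← hu, imMul_anticomm, dot_neg_right, ← dot_imMul, imMul_self, dot_zero_left, neg_zero]
  have hwv : dot w v = 0 := by
    have : dot w (-v) = 0 := by
      rw [← hv, imMul_anticomm, dot_neg_right, ← dot_imMul, imMul_self, dot_zero_left, neg_zero]
    simpa using this
  have e1 := imMul_imMul_polarized u w v
  have e2 := imMul_imMul_polarized v w u
  rw [imMul_anticomm w v, hv] at e1
  rw [imMul_anticomm w u, hu, imMul_anticomm v u] at e2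
  simp only [neg_neg, imMul_neg_right, imMul_anticomm v u, dot_comm u w, dot_comm v w, hwu, hwv,
    dot_comm v u] at e1 e2
  have h2 : (2 : ℂ) • imMul u v = (2 : ℂ) • (dot u v • w) := by
    linear_combination (norm := module) e1 + e2
  exact smul_right_injective V (two_ne_zero : (2 : ℂ) ≠ 0) h2

/-- The product of two eigenvectors for `1` is an eigenvector for `-1`. -/
lemma imMul_eigen_same {w : V} (hu : imMul u w = u) (hv : imMul v w = v) :
    imMul (imMul u v) w = -imMul u v := by
  have hwv : dot w v = 0 := by
    rw [← hv, imMul_anticomm, dot_neg_right, ← dot_imMul, imMul_self, dot_zero_left, neg_zero]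
  have hwu : dot w u = 0 := by
    rw [← hu, imMul_anticomm, dot_neg_right, ← dot_imMul, imMul_self, dot_zero_left, neg_zero]
  have e1 := imMul_imMul_polarized u w v
  rw [imMul_anticomm w v, hv, dot_eq_zero_of_eigen hu hv, hwv, dot_comm u w, hwu,
    imMul_anticomm w (imMul u v)] at e1
  simp only [imMul_neg_right] at e1
  linear_combination (norm := module) -e1

end NullPair

/-- The operator with eigenvalue `a` at `l`, `b` at `l'` and `1` on the orthogonal complement, for
a null pair `l`, `l'`. -/
def flow (l l' : V) (a b : ℂ) (x : V) : V :=
  x + ((a - 1) * dot l' x) • l + ((b - 1) * dot l x) • l'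

lemma flow_add (l l' : V) (a b : ℂ) (x y : V) :
    flow l l' a b (x + y) = flow l l' a b x + flow l l' a b y := by
  simp only [flow, dot_add_right]; module

lemma flow_smul (l l' : V) (a b c : ℂ) (x : V) :
    flow l l' a b (c • x) = c • flow l l' a b x := by
  simp only [flow, dot_smul_right]; module

lemma flow_neg (l l' : V) (a b : ℂ) (x : V) :
    flow l l' a b (-x) = -flow l l' a b x := by
  simpa using flow_smul l l' a b (-1) x

lemma flow_swap (l l' : V) (a b : ℂ) : flow l l' a b = flow l' l b a := by
  funext x; simp only [flow]; module

lemma flow_of_dot_eq_zero {l l' x : V} (a b : ℂ) (h : dot l x = 0) (h' : dot l' x = 0) :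
    flow l l' a b x = x := by
  simp [flow, h, h']

/-! ### Flows along null pairs and the octonionic product -/

namespace NullPair

variable {l l' m m' u v : V} {a b : ℂ}

lemma flow_flow (h : NullPair l l') (hab : a * b = 1) (x : V) :
    flow l l' a b (flow l l' b a x) = x := by
  simp only [flow, dot_add_right, dot_smul_right, h.left, h.right, h.pairing, h.pairing']
  have e1 : (a - 1) * (dot l' x + (b - 1) * dot l' x * 1 + (a - 1) * dot l x * 0)
      + (b - 1) * dot l' x = 0 := by linear_combination dot l' x * hab
  have e2 : (b - 1) * (dot l x + (b - 1) * dot l' x * 0 + (a - 1) * dot l x * 1)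
      + (a - 1) * dot l x = 0 := by linear_combination dot l x * hab
  linear_combination (norm := module) e1 • l + e2 • l'

lemma dot_flow_flow (h : NullPair l l') (hab : a * b = 1) (x y : V) :
    dot (flow l l' a b x) (flow l l' a b y) = dot x y := by
  simp only [flow, dot_add_right, dot_smul_right, dot_add_left, dot_smul_left, h.left, h.right,
    h.pairing, h.pairing', dot_comm x l, dot_comm x l']
  linear_combination (dot l x * dot l' y + dot l' x * dot l y) * hab

lemma flow_cross (l l' : V) (a b : ℂ) :
    flow l l' a b (imMul l l') = imMul l l' :=
  flow_of_dot_eq_zero a b (dot_cross_left l l') (dot_cross_right l l')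

lemma flow_eigen (h : NullPair l l') (hu : imMul u (imMul l l') = u) :
    flow l l' a b u = u + ((a - 1) * dot l' u) • l := by
  simp [flow, dot_eq_zero_of_eigen h.mul_cross_left hu]

lemma imMul_flow_eigen (h : NullPair l l') (hu : imMul u (imMul l l') = u) :
    imMul (flow l l' a b u) (imMul l l') = flow l l' a b u := by
  rw [h.flow_eigen hu, imMul_add_left, imMul_smul_left, hu, h.mul_cross_left]

lemma imMul_flow_eigen_neg (h : NullPair l l') (hu : imMul u (imMul l l') = -u) :
    imMul (flow l l' a b u) (imMul l l') = -flow l l' a b u := by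
  rw [imMul_anticomm l l', imMul_neg_right] at hu ⊢
  rw [flow_swap, h.symm.imMul_flow_eigen (neg_injective hu)]

/-- Expansion of a product of eigenvectors along a null pair. -/
lemma imMul_eq_of_eigen (h : NullPair l l') (hu : imMul u (imMul l l') = u)
    (hv : imMul v (imMul l l') = v) :
    dot l' u • imMul l v - dot l' v • imMul l u = imMul u v - dot l (imMul u v) • l' := by
  set w := imMul l l' with hw
  have hy := imMul_eigen_same hu hv
  set y := imMul u v with hydef
  have hl : imMul l w = l := h.mul_cross_left
  have hl' : imMul l' w = -l' := h.mul_cross_right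
  have hl'y : dot l' y = 0 := by
    refine dot_eq_zero_of_eigen (w := -w) ?_ ?_ <;> simp [hl', hy]
  -- The identity compares two evaluations of l · (l' · y): `e1` moves l past l', and `e2` first
  -- expands l' · (u · v).
  have e1 := imMul_imMul_polarized l l' y
  rw [imMul_eigen_opposite hl hy, imMul_smul_right, hl', hl'y, h.pairing] at e1
  have e2 := imMul_imMul_polarized l' u v
  rw [← hydef, imMul_anticomm l' v, imMul_eigen_opposite hv hl', imMul_neg_right,
    imMul_smul_right, hu, dot_eq_zero_of_eigen hu hv, dot_comm v l'] at e2
  have e3 : imMul l' y = (2 * dot l' v) • u - (2 * dot l' u) • v := by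
    linear_combination (norm := module) e2
  rw [e3, imMul_sub_right, imMul_smul_right, imMul_smul_right] at e1
  linear_combination (norm := module) (-1 / 2 : ℂ) • e1

/-- The product identifies Λ²E₊ with E₋, which is dual to E₊ under `dot`. The flow has determinant a
on E₊ and acts on E₋ by the contragredient, so on Λ²E₊ it differs from its action on E₋ by the
factor a. -/
lemma imMul_flow_flow_eigen (h : NullPair l l') (hab : a * b = 1)
    (hu : imMul u (imMul l l') = u) (hv : imMul v (imMul l l') = v) :
    imMul (flow l l' a b u) (flow l l' a b v) = a • flow l l' a b (imMul u v) := by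
  have e := h.imMul_eq_of_eigen hu hv
  have hl'y : dot l' (imMul u v) = 0 := by
    refine dot_eq_zero_of_eigen (w := -imMul l l') ?_ ?_
    · simp [h.mul_cross_right]
    · simp [imMul_eigen_same hu hv]
  rw [h.flow_eigen hu, h.flow_eigen hv]
  simp only [flow, hl'y, imMul_add_left, imMul_add_right, imMul_smul_left, imMul_smul_right,
    imMul_self, imMul_anticomm u l]
  linear_combination (norm := module) (a - 1) • e - (hab * dot l (imMul u v)) • l'

/-- The composition of the flows of two null pairs with the same cross product, at inverse
parameters, respects the product. -/
theorem imMul_flow_flow (hl : NullPair l l') (hm : NullPair m m')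
    (hw : imMul l l' = imMul m m') (hab : a * b = 1) (u v : V) :
    imMul (flow l l' a b (flow m m' b a u)) (flow l l' a b (flow m m' b a v)) =
      flow l l' a b (flow m m' b a (imMul u v)) := by
  have hba : b * a = 1 := by rw [mul_comm, hab]
  set w := imMul l l' with hwdef
  have hww : dot w w = -1 := hl.cross_dot_cross
  set G : V → V := fun x => flow l l' a b (flow m m' b a x) with hG
  have Gadd : ∀ x y, G (x + y) = G x + G y := fun x y => by simp only [hG, flow_add]
  have Gsmul : ∀ (c : ℂ) x, G (c • x) = c • G x := fun c x => by simp only [hG, flow_smul]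
  have Gneg : ∀ x, G (-x) = -G x := fun x => by simp only [hG, flow_neg]
  have Gw : G w = w := by
    simp only [hG]
    conv_lhs => rw [hw, flow_cross, ← hw, flow_cross]
  have Gdot : ∀ x y, dot (G x) (G y) = dot x y := fun x y => by
    simp only [hG, hl.dot_flow_flow hab, hm.dot_flow_flow hba]
  have Gp : ∀ x, imMul x w = x → imMul (G x) w = G x := fun x hx =>
    hl.imMul_flow_eigen (by rw [← hwdef, hw]; exact hm.imMul_flow_eigen (by rw [← hw, hx]))
  have Gm : ∀ x, imMul x w = -x → imMul (G x) w = -G x := fun x hx =>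
    hl.imMul_flow_eigen_neg (by
      rw [← hwdef, hw]; exact hm.imMul_flow_eigen_neg (by rw [← hw, hx]))
  -- The determinants a and b of the two flows on E₊ cancel.
  have Qpp : ∀ x y, imMul x w = x → imMul y w = y → imMul (G x) (G y) = G (imMul x y) := by
    intro x y hx hy
    have hx' : imMul (flow m m' b a x) w = flow m m' b a x := by
      rw [hw]; exact hm.imMul_flow_eigen (by rw [← hw, hx])
    have hy' : imMul (flow m m' b a y) w = flow m m' b a y := by
      rw [hw]; exact hm.imMul_flow_eigen (by rw [← hw, hy])
    simp only [hG]
    rw [hl.imMul_flow_flow_eigen hab hx' hy', hm.imMul_flow_flow_eigen hba (by rw [← hw, hx])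
      (by rw [← hw, hy]), flow_smul, smul_smul, hab, one_smul]
  -- Swapping both null pairs replaces w by -w, so that E₋ becomes the eigenspace for 1 and the
  -- previous argument applies.
  have Qmm : ∀ x y, imMul x w = -x → imMul y w = -y → imMul (G x) (G y) = G (imMul x y) := by
    intro x y hx hy
    have hwl : imMul l' l = -w := by rw [imMul_anticomm]
    have hwm : imMul m' m = -w := by rw [imMul_anticomm, hw]
    have t : ∀ x, imMul x w = -x → imMul (flow m m' b a x) (imMul l' l) = flow m m' b a x := by
      intro x hx
      rw [flow_swap, hwl, ← hwm]
      exact hm.symm.imMul_flow_eigen (by rw [hwm]; simp [hx])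
    simp only [hG]
    rw [flow_swap l l', hl.symm.imMul_flow_flow_eigen hba (t x hx) (t y hy), flow_swap m m',
      hm.symm.imMul_flow_flow_eigen hab (by rw [hwm]; simp [hx])
      (by rw [hwm]; simp [hy]), flow_smul, smul_smul, hba, one_smul]
  have Qpm : ∀ x y, imMul x w = x → imMul y w = -y → imMul (G x) (G y) = G (imMul x y) := by
    intro x y hx hy
    rw [imMul_eigen_opposite (Gp x hx) (Gm y hy), imMul_eigen_opposite hx hy, Gdot,
      Gsmul, Gw]
  have Qmp : ∀ x y, imMul x w = -x → imMul y w = y → imMul (G x) (G y) = G (imMul x y) := by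
    intro x y hx hy
    rw [imMul_anticomm, Qpm y x hy hx, imMul_anticomm x y, Gneg]
  have Qpw : ∀ x, imMul x w = x → imMul (G x) (G w) = G (imMul x w) := by
    intro x hx; rw [Gw, Gp x hx, hx]
  have Qmw : ∀ x, imMul x w = -x → imMul (G x) (G w) = G (imMul x w) := by
    intro x hx; rw [Gw, Gm x hx, hx, Gneg]
  have Qsw : ∀ x y, imMul (G x) (G y) = G (imMul x y) → imMul (G y) (G x) = G (imMul y x) := by
    intro x y h; rw [imMul_anticomm, h, imMul_anticomm y x, Gneg]
  have dec : ∀ x : V, ∃ p n : V, ∃ c : ℂ, x = p + n + c • w ∧ imMul p w = p ∧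
      imMul n w = -n := by
    intro x
    -- Right multiplication by w is an involution on the complement of w, so half the sum and half
    -- the difference project to its eigenspaces.
    have hS : imMul (imMul x w) w = x + dot w x • w := by
      rw [imMul_anticomm, imMul_anticomm x w, imMul_neg_right, neg_neg, imMul_imMul_self, hww]
      module
    refine ⟨(1 / 2 : ℂ) • (x + dot w x • w + imMul x w), (1 / 2 : ℂ) • (x + dot w x • w - imMul x w),
      -dot w x, by module, ?_, ?_⟩
    · simp only [imMul_smul_left, imMul_add_left, imMul_self, hS]; module
    · simp only [imMul_smul_left, imMul_add_left, imMul_sub_left, imMul_self, hS]; module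
  obtain ⟨p, n, c, rfl, hp, hn⟩ := dec u
  obtain ⟨p', n', c', rfl, hp', hn'⟩ := dec v
  change imMul (G _) (G _) = G _
  simp only [Gadd, Gsmul, imMul_add_left, imMul_add_right, imMul_smul_left, imMul_smul_right]
  rw [Qpp p p' hp hp', Qmm n n' hn hn', Qpm p n' hp hn', Qmp n p' hn hp', Qpw p hp, Qmw n hn,
    Qsw _ _ (Qpw p' hp'), Qsw _ _ (Qmw n' hn'), Gw, imMul_self]
  have G0 : G 0 = 0 := by simpa using Gsmul 0 0
  rw [G0]

/-! ### Coassociative planes and cross products -/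

/-- Orthonormal vectors of a coassociative plane have opposite cross products. -/
lemma cross_add_cross_of_imMul_eq_zero (hl : NullPair l (conjV l)) (hn : NullPair u (conjV u))
    (h0 : dot l u = 0) (h1 : dot (conjV l) u = 0) (hz : imMul l u = 0) :
    imMul l (conjV l) + imMul u (conjV u) = 0 := by
  set w := imMul l (conjV l) with hw
  set w' := imMul u (conjV u) with hw'
  have e1 := imMul_imMul_polarized u l (conjV l)
  rw [← hw, dot_comm u (conjV l), h1, hl.pairing, dot_comm u l, h0] at e1
  have e2 := imMul_imMul_polarized l (conjV l) u
  rw [hz, imMul_zero_right, h0, h1, hl.pairing, imMul_anticomm (conjV l) u, imMul_neg_right] at e2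
  have e3 : imMul u w = -u := by linear_combination (norm := module) e1 + e2
  have hww' : dot w w' = 1 := by
    rw [hw', ← dot_imMul, imMul_anticomm w u, e3, neg_neg, hn.pairing]
  have cw : conjV w = -w := by
    rw [hw, ← imMul_conjV_conjV, conjV_conjV, imMul_anticomm]
  have cw' : conjV w' = -w' := by
    rw [hw', ← imMul_conjV_conjV, conjV_conjV, imMul_anticomm]
  -- Since w and w' are purely imaginary, the squared Hermitian norm of w + w' is -⟨w + w', w + w'⟩
  -- = 1 - 2 + 1 = 0.
  rw [← dot_conjV_self_eq_zero, conjV_add, cw, cw']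
  simp only [dot_add_left, dot_add_right, dot_neg_left, dot_comm w' w, hww']
  rw [show dot w w = -1 from hl.cross_dot_cross, show dot w' w' = -1 from hn.cross_dot_cross]
  ring

end NullPair

/-! ### Lines, planes and the simple factors -/

@[simp] lemma mem_conjSub {W : Submodule ℂ V} {x : V} : x ∈ conjSub W ↔ conjV x ∈ W := Iff.rfl

@[simp] lemma mem_perp {W : Submodule ℂ V} {x : V} : x ∈ perp W ↔ ∀ y ∈ W, dot x y = 0 := Iff.rfl

lemma conjSub_conjSub (W : Submodule ℂ V) : conjSub (conjSub W) = W := by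
  ext x; simp

lemma conjSub_span_singleton (l : V) : conjSub (ℂ ∙ l) = ℂ ∙ conjV l := by
  ext x
  simp only [mem_conjSub, Submodule.mem_span_singleton]
  constructor
  · rintro ⟨c, hc⟩
    exact ⟨starRingEnd ℂ c, by rw [← conjV_smul, hc, conjV_conjV]⟩
  · rintro ⟨c, hc⟩
    exact ⟨starRingEnd ℂ c, by rw [← hc, conjV_smul, conjV_conjV]⟩

lemma conjSub_mono {U W : Submodule ℂ V} (h : U ≤ W) : conjSub U ≤ conjSub W := fun _ hx => h hx

lemma conjSub_sup (U W : Submodule ℂ V) : conjSub (U ⊔ W) = conjSub U ⊔ conjSub W := by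
  apply le_antisymm
  · have h : U ⊔ W ≤ conjSub (conjSub U ⊔ conjSub W) := by
      refine sup_le ?_ ?_
      · conv_lhs => rw [← conjSub_conjSub U]
        exact conjSub_mono le_sup_left
      · conv_lhs => rw [← conjSub_conjSub W]
        exact conjSub_mono le_sup_right
    simpa [conjSub_conjSub] using conjSub_mono h
  · exact sup_le (conjSub_mono le_sup_left) (conjSub_mono le_sup_right)

lemma perp_eq_orthogonal (W : Submodule ℂ V) : perp W = (conjSub W)ᗮ := by
  ext x
  rw [Submodule.mem_orthogonal, mem_perp]
  constructor
  · intro h y hy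
    rw [inner_eq_dot, dot_comm]; exact h _ hy
  · intro h y hy
    have := h (conjV y) (by simpa using hy)
    rwa [inner_eq_dot, conjV_conjV, dot_comm] at this

lemma perp_sup_conjSub (W : Submodule ℂ V) : perp (W ⊔ conjSub W) = (W ⊔ conjSub W)ᗮ := by
  rw [perp_eq_orthogonal, conjSub_sup, conjSub_conjSub, sup_comm]

lemma starProjection_sup_of_isOrtho {U W : Submodule ℂ V} (h : U ⟂ W) :
    (U ⊔ W).starProjection = U.starProjection + W.starProjection := by
  ext1 x
  apply Submodule.eq_starProjection_of_mem_orthogonal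
  · exact Submodule.add_mem_sup (Submodule.starProjection_apply_mem _ _)
      (Submodule.starProjection_apply_mem _ _)
  · rw [← Submodule.inf_orthogonal, Submodule.mem_inf]
    have hU := Submodule.sub_starProjection_mem_orthogonal (K := U) x
    have hW := Submodule.sub_starProjection_mem_orthogonal (K := W) x
    constructor
    · have : W.starProjection x ∈ Uᗮ := h.symm (Submodule.starProjection_apply_mem _ _)
      convert Uᗮ.sub_mem hU this using 1
      simp only [add_apply]; abel
    · have : U.starProjection x ∈ Wᗮ := h (Submodule.starProjection_apply_mem _ _)
      convert Wᗮ.sub_mem hW this using 1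
      simp only [add_apply]; abel

lemma IsIsotropic.isOrtho_conjSub {W : Submodule ℂ V} (h : IsIsotropic W) : W ⟂ conjSub W := by
  rw [Submodule.isOrtho_comm, Submodule.isOrtho_iff_inner_eq]
  intro x hx y hy
  rw [inner_eq_dot]; exact h _ hx _ hy

/-- Isotropy of W is Hermitian orthogonality of W and W̄, so the middle projection is the identity
minus the other two. -/
lemma simpleFactor_eq_of_isIsotropic {W : Submodule ℂ V} (h : IsIsotropic W) (α z : ℂ) :
    simpleFactor α W z = 1
      + ((z - α) / (z - starRingEnd ℂ α) - 1) • W.starProjection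
      + ((z - starRingEnd ℂ α) / (z - α) - 1) • (conjSub W).starProjection := by
  have hp : (perp (W ⊔ conjSub W)).starProjection =
      1 - (W.starProjection + (conjSub W).starProjection) := by
    simp only [perp_sup_conjSub, Submodule.starProjection_orthogonal',
      starProjection_sup_of_isOrtho h.isOrtho_conjSub]
  rw [simpleFactor, hp]
  module

/-- A unit isotropic vector forms a null pair with its conjugate. -/
lemma IsIsotropicLine.exists_eq_span {L : Submodule ℂ V} (h : IsIsotropicLine L) :
    ∃ l, NullPair l (conjV l) ∧ L = ℂ ∙ l := by
  obtain ⟨h1, hi⟩ := h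
  obtain ⟨v, hv, hL⟩ := finrank_eq_one_iff'.mp h1
  have hv0 : (v : V) ≠ 0 := by simpa using hv
  have hn : ((‖(v : V)‖ : ℂ)) ≠ 0 := by simpa using hv0
  have hd : dot (v : V) (conjV v) = (‖(v : V)‖ : ℂ) ^ 2 := by
    rw [dot_comm, ← inner_eq_dot, inner_self_eq_norm_sq_to_K]; rfl
  have hvv := hi _ v.2 _ v.2
  refine ⟨((‖(v : V)‖ : ℂ))⁻¹ • (v : V), ⟨?_, ?_, ?_⟩, ?_⟩
  · simp [hvv]
  · rw [dot_conjV_conjV]; simp [hvv]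
  · simp [hd]; field_simp
  · apply le_antisymm
    · intro x hx
      obtain ⟨c, hc⟩ := hL ⟨x, hx⟩
      rw [Submodule.mem_span_singleton]
      refine ⟨c * (‖(v : V)‖ : ℂ), ?_⟩
      rw [smul_smul, mul_assoc, mul_inv_cancel₀ hn, mul_one]
      exact congrArg Subtype.val hc
    · rw [Submodule.span_singleton_le_iff_mem]
      exact L.smul_mem _ v.2

namespace NullPair

variable {l m k n : V}

lemma conj (h : NullPair l (conjV l)) : NullPair (conjV l) (conjV (conjV l)) := by
  rw [conjV_conjV]; exact h.symm

lemma ne_zero {l' : V} (h : NullPair l l') : l ≠ 0 := by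
  rintro rfl; simpa using h.pairing

lemma isIsotropicLine_span (h : NullPair l (conjV l)) : IsIsotropicLine (ℂ ∙ l) := by
  refine ⟨finrank_span_singleton h.ne_zero, ?_⟩
  intro x hx y hy
  obtain ⟨c, rfl⟩ := Submodule.mem_span_singleton.mp hx
  obtain ⟨d, rfl⟩ := Submodule.mem_span_singleton.mp hy
  simp [h.left]

lemma norm_eq_one (h : NullPair l (conjV l)) : ‖l‖ = 1 := by
  have h1 : ((‖l‖ : ℂ)) ^ 2 = 1 := by
    rw [← h.pairing', ← inner_eq_dot, inner_self_eq_norm_sq_to_K]; rfl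
  have h2 : ‖l‖ ^ 2 = 1 := by exact_mod_cast h1
  exact (pow_eq_one_iff_of_nonneg (norm_nonneg _) two_ne_zero).mp h2

lemma starProjection_span (h : NullPair l (conjV l)) (x : V) :
    (ℂ ∙ l).starProjection x = dot (conjV l) x • l := by
  rw [Submodule.starProjection_unit_singleton ℂ h.norm_eq_one, inner_eq_dot]

lemma starProjection_conjSub_span (h : NullPair l (conjV l)) (x : V) :
    (conjSub (ℂ ∙ l)).starProjection x = dot l x • conjV l := by
  have := h.conj.starProjection_span x
  rw [conjV_conjV] at this
  simp only [conjSub_span_singleton, this]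

/-- This is the bridge from loops to the algebra of flows: the two parameters are inverse to each
other away from the poles. -/
lemma simpleFactor_span (h : NullPair l (conjV l)) (α z : ℂ) (x : V) :
    simpleFactor α (ℂ ∙ l) z x = flow l (conjV l) ((z - α) / (z - starRingEnd ℂ α))
      ((z - starRingEnd ℂ α) / (z - α)) x := by
  rw [simpleFactor_eq_of_isIsotropic h.isIsotropicLine_span.2]
  simp [h.starProjection_span, h.starProjection_conjSub_span, flow, mul_smul]

lemma mem_perp_span {x : V} : x ∈ perp (ℂ ∙ l) ↔ dot l x = 0 := by
  rw [mem_perp]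
  constructor
  · intro h; rw [dot_comm]; exact h l (Submodule.mem_span_singleton_self l)
  · intro h y hy
    obtain ⟨c, rfl⟩ := Submodule.mem_span_singleton.mp hy
    rw [dot_smul_right, dot_comm, h, mul_zero]

lemma span_le_perp_conjSub : (ℂ ∙ k) ≤ perp (conjSub (ℂ ∙ l)) ↔ dot (conjV l) k = 0 := by
  rw [Submodule.span_singleton_le_iff_mem, conjSub_span_singleton, mem_perp_span]

lemma span_le_perp_sup : (ℂ ∙ k) ≤ perp ((ℂ ∙ l) ⊔ conjSub (ℂ ∙ l)) ↔
    dot l k = 0 ∧ dot (conjV l) k = 0 := by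
  rw [Submodule.span_singleton_le_iff_mem, conjSub_span_singleton, perp_eq_orthogonal, conjSub_sup,
    ← Submodule.inf_orthogonal, Submodule.mem_inf, ← perp_eq_orthogonal, ← perp_eq_orthogonal,
    mem_perp_span, mem_perp_span]

lemma pairPlane_span (h : NullPair l (conjV l)) : pairPlane (ℂ ∙ l) (ℂ ∙ k) =
    (ℂ ∙ l) ⊔ (ℂ ∙ (k - dot (conjV l) k • l - dot l k • conjV l)) := by
  rw [pairPlane, Submodule.map_span, Set.image_singleton]
  congr 3
  simp only [perp_sup_conjSub, ContinuousLinearMap.coe_coe, Submodule.starProjection_orthogonal',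
    starProjection_sup_of_isOrtho h.isIsotropicLine_span.2.isOrtho_conjSub]
  simp [h.starProjection_span, h.starProjection_conjSub_span]
  abel

end NullPair

lemma isCoassociative_span_sup {l n : V} (hl0 : l ≠ 0) (hn0 : n ≠ 0) (hl : dot l l = 0)
    (hn : dot n n = 0) (hln : dot l n = 0) (ho : dot (conjV l) n = 0) (hm : imMul l n = 0) :
    IsCoassociative ((ℂ ∙ l) ⊔ (ℂ ∙ n)) := by
  have hort : (ℂ ∙ l) ⟂ (ℂ ∙ n) := by
    rw [Submodule.isOrtho_span]
    rintro _ rfl _ rfl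
    rw [inner_eq_dot, ho]
  refine ⟨?_, ?_, ?_⟩
  · have := Submodule.finrank_sup_add_finrank_inf_eq (ℂ ∙ l) (ℂ ∙ n)
    rw [hort.disjoint.eq_bot, finrank_bot, finrank_span_singleton hl0,
      finrank_span_singleton hn0] at this
    exact this
  all_goals
    intro x hx y hy
    obtain ⟨_, h1, _, h2, rfl⟩ := Submodule.mem_sup.mp hx
    obtain ⟨_, h3, _, h4, rfl⟩ := Submodule.mem_sup.mp hy
    obtain ⟨a, rfl⟩ := Submodule.mem_span_singleton.mp h1
    obtain ⟨b, rfl⟩ := Submodule.mem_span_singleton.mp h2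
    obtain ⟨c, rfl⟩ := Submodule.mem_span_singleton.mp h3
    obtain ⟨d, rfl⟩ := Submodule.mem_span_singleton.mp h4
  · simp [hl, hn, hln, dot_comm n l]
  · simp [hm, imMul_anticomm n l]

namespace NullPair

variable {l m k n : V}

/-- The pair condition in terms of cross products. -/
lemma pairCondition_iff (hl : NullPair l (conjV l)) (hk : NullPair k (conjV k)) :
    PairCondition (ℂ ∙ l) (ℂ ∙ k) ↔
      (ℂ ∙ k) ≠ conjSub (ℂ ∙ l) ∧ imMul l (conjV l) = imMul (conjV k) k := by
  rw [PairCondition, hl.pairPlane_span, span_le_perp_conjSub]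
  set n := k - dot (conjV l) k • l - dot l k • conjV l with hn
  have hspan : (ℂ ∙ k) = conjSub (ℂ ∙ l) ↔ k ∈ ℂ ∙ conjV l := by
    rw [conjSub_span_singleton]
    constructor
    · intro h; rw [← h]; exact Submodule.mem_span_singleton_self k
    · intro h
      obtain ⟨c, rfl⟩ := Submodule.mem_span_singleton.mp h
      have hc : c ≠ 0 := by rintro rfl; exact hk.ne_zero (by simp)
      exact Submodule.span_singleton_smul_eq hc.isUnit _
  constructor
  · rintro ⟨h0, h2, -, hmul⟩
    have hn' : n = k - dot l k • conjV l := by rw [hn, h0]; module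
    have hn0 : n ≠ 0 := by
      intro h
      rw [h, Submodule.span_zero_singleton, sup_bot_eq, finrank_span_singleton hl.ne_zero] at h2
      exact absurd h2 (by norm_num)
    refine ⟨fun h => hn0 ?_, ?_⟩
    · obtain ⟨c, hc⟩ := Submodule.mem_span_singleton.mp (hspan.mp h)
      rw [hn', ← hc, dot_smul_right, hl.pairing]; module
    · have hz : imMul l n = 0 := hmul _ (Submodule.mem_sup_left (Submodule.mem_span_singleton_self l))
        _ (Submodule.mem_sup_right (Submodule.mem_span_singleton_self n))
      have hl'n : dot (conjV l) n = 0 := by rw [hn']; simp [h0, hl.right]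
      have hln : dot l n = 0 := by rw [hn']; simp [hl.pairing]
      have hnn : dot n n = 0 := by
        rw [hn']; simp [hk.left, hl.right, dot_comm k (conjV l), h0]
      obtain ⟨u, hu, hus⟩ := IsIsotropicLine.exists_eq_span (L := ℂ ∙ n)
        ⟨finrank_span_singleton hn0, by
          intro x hx y hy
          obtain ⟨a, rfl⟩ := Submodule.mem_span_singleton.mp hx
          obtain ⟨b, rfl⟩ := Submodule.mem_span_singleton.mp hy
          simp [hnn]⟩
      obtain ⟨t, ht⟩ : ∃ t : ℂ, t • n = u := Submodule.mem_span_singleton.mp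
        (hus ▸ Submodule.mem_span_singleton_self u)
      obtain ⟨s, hs⟩ : ∃ s : ℂ, s • u = n := Submodule.mem_span_singleton.mp
        (hus ▸ Submodule.mem_span_singleton_self n)
      have hcross := hl.cross_add_cross_of_imMul_eq_zero hu (by simp [← ht, hln])
        (by simp [← ht, hl'n]) (by simp [← ht, hz])
      -- In the Hermitian orthonormal vectors u and l̄, the mixed terms of k̄ · k vanish and both
      -- diagonal terms are multiples of l · l̄, with total coefficient |s|² + |c|² = 1.
      obtain ⟨c, hkeq⟩ : ∃ c : ℂ, k = s • u + c • conjV l := ⟨dot l k, by rw [hs, hn']; module⟩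
      have hlu : imMul l u = 0 := by simp [← ht, hz]
      have hlu' : imMul (conjV l) (conjV u) = 0 := by rw [imMul_conjV_conjV, hlu, conjV_zero]
      have hd1 : dot (conjV u) (conjV l) = 0 := by
        rw [dot_conjV_conjV, dot_comm, ← ht]; simp [hln]
      have hd2 : dot u l = 0 := by rw [dot_comm, ← ht]; simp [hln]
      have hnorm := hk.pairing
      rw [hkeq] at hnorm ⊢
      simp only [conjV_add, conjV_smul, conjV_conjV, dot_add_left, dot_add_right, dot_smul_left,
        dot_smul_right, hu.pairing, hl.pairing', hd2, dot_comm (conjV l) (conjV u), hd1] at hnorm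
      simp only [conjV_add, conjV_smul, conjV_conjV, imMul_add_left, imMul_add_right,
        imMul_smul_left, imMul_smul_right, hlu, imMul_anticomm (conjV u) (conjV l), hlu']
      have h1 : imMul (conjV u) u = imMul l (conjV l) := by
        rw [imMul_anticomm]; linear_combination (norm := module) -hcross
      rw [h1]
      linear_combination (norm := module) -(hnorm • imMul l (conjV l))
  · rintro ⟨hne, hw⟩
    have hl1 : imMul l (imMul l (conjV l)) = l := hl.mul_cross_left
    have hl2 : imMul (conjV l) (imMul l (conjV l)) = -conjV l := hl.mul_cross_right
    have hk1 : imMul k (imMul l (conjV l)) = -k := by rw [hw]; exact hk.symm.mul_cross_right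
    -- Both l̄ and k lie in the eigenspace of w for -1, which is isotropic.
    have h0 : dot (conjV l) k = 0 :=
      dot_eq_zero_of_eigen (w := -imMul l (conjV l)) (by simp [hl2]) (by simp [hk1])
    have hn' : n = k - dot l k • conjV l := by rw [hn, h0]; module
    refine ⟨h0, isCoassociative_span_sup hl.ne_zero ?_ hl.left ?_ ?_ ?_ ?_⟩
    · intro h
      apply hne
      rw [hspan, Submodule.mem_span_singleton]
      exact ⟨dot l k, by linear_combination (norm := module) hn' - h⟩
    · rw [hn']; simp [hk.left, hl.right, dot_comm k (conjV l), h0]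
    · rw [hn']; simp [hl.pairing]
    · rw [hn']; simp [h0, hl.right]
    -- Here l is in E₊ and k in E₋, so l · k = ⟨l, k⟩ w, which is cancelled by the term ⟨l, k⟩ l ·
    -- l̄.
    · rw [hn', imMul_sub_right, imMul_smul_right, imMul_eigen_opposite hl1 hk1, sub_self]

end NullPair

/-! ### The group `𝔾₂` -/

/-- An algebra automorphism fixes the unit. The real part of the product of two imaginary elements
is minus the bilinear form and the imaginary part is the cross product, so both are preserved. -/
lemma InG2.dot_imMul_eq {A : V →L[ℂ] V} (h : InG2 A) (x y : V) :
    dot (A x) (A y) = dot x y ∧ imMul (A x) (A y) = A (imMul x y) := by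
  obtain ⟨φ, hφ, hA⟩ := h
  have h1 : φ (1, 0) = (1, 0) := by
    have e := hφ (1, 0) (φ.symm (1, 0))
    have e1 : ∀ q : ℂ × V, octMul (1, 0) q = q := by intro q; simp [octMul]
    have e2 : ∀ q : ℂ × V, octMul q (1, 0) = q := by intro q; simp [octMul]
    rw [e1, φ.apply_symm_apply, e2] at e
    exact e.symm
  have h2 : ∀ (c : ℂ) (v : V), φ (c, v) = (c, A v) := by
    intro c v
    have : ((c, v) : ℂ × V) = c • (1, 0) + (0, v) := by simp
    rw [this, map_add, map_smul, h1, hA]; simp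
  have e := hφ (0, x) (0, y)
  rw [hA, hA] at e
  simp only [octMul, zero_mul, zero_sub, zero_smul, zero_add] at e
  rw [h2, Prod.mk.injEq, neg_inj] at e
  exact ⟨e.1.symm, e.2.symm⟩

lemma inG2_of_imMul {A B : V →L[ℂ] V} (hAB : ∀ x, A (B x) = x) (hBA : ∀ x, B (A x) = x)
    (hd : ∀ x y, dot (A x) (A y) = dot x y) (hm : ∀ x y, imMul (A x) (A y) = A (imMul x y)) :
    InG2 A := by
  let e : V ≃ₗ[ℂ] V := LinearEquiv.ofLinearMap (A : V →ₗ[ℂ] V) (B : V →ₗ[ℂ] V)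
    (by ext1 x; exact hAB x) (by ext1 x; exact hBA x)
  refine ⟨(LinearEquiv.refl ℂ ℂ).prodCongr e, ?_, ?_⟩
  · rintro ⟨c, x⟩ ⟨d, y⟩
    simp [octMul, e, hd, hm]
  · intro v; simp [e]

/-- As a representation of 𝔾₂, so(7) is 𝔤₂ ⊕ ℂ⁷, and x ∧ y ↦ x · y is, up to scale, the projection
to ℂ⁷. It vanishes on derivations, in particular on l ∧ l' - m ∧ m'. -/
lemma cross_eq_of_derivation {l l' m m' : V} {D : V → V}
    (hD : ∀ x, D x = dot l' x • l - dot l x • l' - (dot m' x • m - dot m x • m'))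
    (h : ∀ x y, D (imMul x y) = imMul (D x) y + imMul x (D y)) :
    imMul l l' = imMul m m' := by
  have key : ∀ i j k : Fin 7,
      (D (imMul (EuclideanSpace.single i 1) (EuclideanSpace.single j 1))) k =
      (imMul (D (EuclideanSpace.single i 1)) (EuclideanSpace.single j 1) +
        imMul (EuclideanSpace.single i 1) (D (EuclideanSpace.single j 1))) k :=
    fun i j k => by rw [h]
  -- Each of these seven matrix coefficients of the derivation rule yields one coordinate of the
  -- equation.
  have k0 := key 4 5 3
  have k1 := key 0 6 5
  have k2 := key 0 6 4
  have k3 := key 0 1 2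
  have k4 := key 1 3 6
  have k5 := key 2 1 4
  have k6 := key 3 2 5
  simp [hD, imMul, dot, Fin.sum_univ_succ] at k0 k1 k2 k3 k4 k5 k6
  ext i
  fin_cases i <;> simp [imMul]
  · linear_combination -k0
  · linear_combination -k1
  · linear_combination k2
  · linear_combination -k3
  · linear_combination -k4
  · linear_combination -k5
  · linear_combination -k6

lemma continuous_imMul : Continuous fun p : V × V => imMul p.1 p.2 := by
  unfold imMul
  refine (PiLp.continuous_toLp 2 _).comp (continuous_pi fun i => ?_)
  fin_cases i <;> simp <;> fun_prop

lemma continuous_dot : Continuous fun p : V × V => dot p.1 p.2 := by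
  unfold dot
  fun_prop

lemma tendsto_imMul {ι : Type*} {F : Filter ι} {f g : ι → V} {x y : V} (hf : Tendsto f F (𝓝 x))
    (hg : Tendsto g F (𝓝 y)) : Tendsto (fun z => imMul (f z) (g z)) F (𝓝 (imMul x y)) :=
  Tendsto.comp (g := fun p : V × V => imMul p.1 p.2) (f := fun z => (f z, g z))
    (continuous_imMul.tendsto (x, y)) (hf.prodMk_nhds hg)

lemma tendsto_dot {ι : Type*} {F : Filter ι} {f g : ι → V} {x y : V} (hf : Tendsto f F (𝓝 x))
    (hg : Tendsto g F (𝓝 y)) : Tendsto (fun z => dot (f z) (g z)) F (𝓝 (dot x y)) :=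
  Tendsto.comp (g := fun p : V × V => dot p.1 p.2) (f := fun z => (f z, g z))
    (continuous_dot.tendsto (x, y)) (hf.prodMk_nhds hg)

/-! ### Asymptotics at infinity -/

lemma tendsto_inv_sub_cobounded (c : ℂ) :
    Tendsto (fun z : ℂ => (z - c)⁻¹) (Bornology.cobounded ℂ) (𝓝 0) :=
  tendsto_inv₀_cobounded.comp (tendsto_sub_const_cobounded c)

lemma div_sub_one_eventuallyEq (c d : ℂ) :
    (fun z : ℂ => (z - c) / (z - d) - 1) =ᶠ[Bornology.cobounded ℂ]
      fun z => (d - c) * (z - d)⁻¹ := by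
  filter_upwards [Bornology.eventually_ne_cobounded d] with z hz
  have : z - d ≠ 0 := sub_ne_zero.mpr hz
  field_simp
  ring

lemma tendsto_div_sub_one (c d : ℂ) :
    Tendsto (fun z : ℂ => (z - c) / (z - d) - 1) (Bornology.cobounded ℂ) (𝓝 0) := by
  rw [tendsto_congr' (div_sub_one_eventuallyEq c d)]
  simpa using (tendsto_inv_sub_cobounded d).const_mul (d - c)

lemma tendsto_mul_div_sub_one (c d : ℂ) :
    Tendsto (fun z : ℂ => z * ((z - c) / (z - d) - 1)) (Bornology.cobounded ℂ) (𝓝 (d - c)) := by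
  have h : (fun z : ℂ => z * ((z - c) / (z - d) - 1)) =ᶠ[Bornology.cobounded ℂ]
      fun z => (d - c) + (d - c) * d * (z - d)⁻¹ := by
    filter_upwards [Bornology.eventually_ne_cobounded d] with z hz
    have : z - d ≠ 0 := sub_ne_zero.mpr hz
    field_simp
    ring
  rw [tendsto_congr' h]
  simpa using ((tendsto_inv_sub_cobounded d).const_mul ((d - c) * d)).const_add (d - c)

/-- A loop is controlled only on a dense set; this lets limits at infinity be taken along that set.
-/
lemma cobounded_inf_principal_neBot {U : Set ℂ} (hU : Dense U) :
    (Bornology.cobounded ℂ ⊓ 𝓟 U).NeBot := by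
  rw [inf_principal_neBot_iff]
  intro s hs
  obtain ⟨R, hR⟩ := (Metric.isBounded_iff_subset_closedBall (0 : ℂ)).mp
    (Bornology.isBounded_compl_iff.mpr hs)
  have hopen : IsOpen (Metric.closedBall (0 : ℂ) R)ᶜ := Metric.isClosed_closedBall.isOpen_compl
  have hnon : ((Metric.closedBall (0 : ℂ) R)ᶜ).Nonempty := by
    refine ⟨((|R| + 1 : ℝ) : ℂ), ?_⟩
    have h1 : |(|R| + 1)| = |R| + 1 := abs_of_nonneg (by positivity)
    simp only [Set.mem_compl_iff, mem_closedBall_zero_iff, not_le, Complex.norm_real,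
      Real.norm_eq_abs, h1]
    linarith [le_abs_self R]
  obtain ⟨z, hz, hzU⟩ := hU.inter_open_nonempty _ hopen hnon
  exact ⟨z, by_contra fun h => hz (hR h), hzU⟩

lemma tendsto_flow {F : Filter ℂ} {a b : ℂ → ℂ} {y : ℂ → V} {x : V} (l l' : V)
    (ha : Tendsto (fun z => a z - 1) F (𝓝 0)) (hb : Tendsto (fun z => b z - 1) F (𝓝 0))
    (hy : Tendsto y F (𝓝 x)) :
    Tendsto (fun z => flow l l' (a z) (b z) (y z)) F (𝓝 x) := by
  have hd : ∀ u : V, Tendsto (fun z => dot u (y z)) F (𝓝 (dot u x)) := fun u =>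
    tendsto_dot tendsto_const_nhds hy
  simpa [flow] using (hy.add ((ha.mul (hd l')).smul_const l)).add ((hb.mul (hd l)).smul_const l')

lemma tendsto_smul_flow_sub {F : Filter ℂ} {a b : ℂ → ℂ} {y : ℂ → V} {x : V} {c d : ℂ} (l l' : V)
    (ha : Tendsto (fun z => z * (a z - 1)) F (𝓝 c)) (hb : Tendsto (fun z => z * (b z - 1)) F (𝓝 d))
    (hy : Tendsto y F (𝓝 x)) :
    Tendsto (fun z => z • (flow l l' (a z) (b z) (y z) - y z)) F
      (𝓝 ((c * dot l' x) • l + (d * dot l x) • l')) := by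
  have hd : ∀ u : V, Tendsto (fun z => dot u (y z)) F (𝓝 (dot u x)) := fun u =>
    tendsto_dot tendsto_const_nhds hy
  refine (((ha.mul (hd l')).smul_const l).add ((hb.mul (hd l)).smul_const l')).congr fun z => ?_
  simp only [flow]
  module

/-- If a product of two flows respects the octonionic product, the cross products agree. -/
lemma cross_eq_of_imMul_flow_flow {α : ℂ} (hα : α.im ≠ 0) {l k : V} {U : Set ℂ} (hU : Dense U)
    {g : ℂ → V → V} (hg : ∀ z ∈ U, ∀ x, g z x =
      flow l (conjV l) ((z - α) / (z - starRingEnd ℂ α)) ((z - starRingEnd ℂ α) / (z - α))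
        (flow k (conjV k) ((z - α) / (z - starRingEnd ℂ α)) ((z - starRingEnd ℂ α) / (z - α)) x))
    (hgG : ∀ z ∈ U, ∀ x y, imMul (g z x) (g z y) = g z (imMul x y)) :
    imMul l (conjV l) = imMul (conjV k) k := by
  have hne := cobounded_inf_principal_neBot hU
  set F := Bornology.cobounded ℂ ⊓ 𝓟 U with hF
  have hle : F ≤ Bornology.cobounded ℂ := inf_le_left
  set β := starRingEnd ℂ α - α with hβ
  have hβ0 : β ≠ 0 := by
    intro h
    apply hα
    have := congrArg Complex.im h
    simp [hβ] at this
    linarith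
  set a : ℂ → ℂ := fun z => (z - α) / (z - starRingEnd ℂ α) with ha
  set b : ℂ → ℂ := fun z => (z - starRingEnd ℂ α) / (z - α) with hb
  have ha1 : Tendsto (fun z => a z - 1) F (𝓝 0) := (tendsto_div_sub_one _ _).mono_left hle
  have hb1 : Tendsto (fun z => b z - 1) F (𝓝 0) := (tendsto_div_sub_one _ _).mono_left hle
  have ha2 : Tendsto (fun z => z * (a z - 1)) F (𝓝 β) :=
    (tendsto_mul_div_sub_one _ _).mono_left hle
  have hb2 : Tendsto (fun z => z * (b z - 1)) F (𝓝 (-β)) := by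
    rw [hβ, neg_sub]; exact (tendsto_mul_div_sub_one _ _).mono_left hle
  have hmem : ∀ᶠ z in F, z ∈ U := mem_inf_of_right (mem_principal_self U)
  set D : V → V := fun x => dot (conjV l) x • l - dot l x • conjV l
    - (dot k x • conjV k - dot (conjV k) x • k) with hD
  have hg1 : ∀ x, Tendsto (fun z => g z x) F (𝓝 x) := fun x =>
    (tendsto_flow l (conjV l) ha1 hb1 (tendsto_flow k (conjV k) ha1 hb1 tendsto_const_nhds)).congr'
      (hmem.mono fun z hz => (hg z hz x).symm)
  -- The first-order term of g at infinity is β D: the factors contribute additively, and the second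
  -- appears in D with the order k̄, k.
  have hg2 : ∀ x, Tendsto (fun z => z • (g z x - x)) F (𝓝 (β • D x)) := by
    intro x
    have h1 := tendsto_smul_flow_sub (x := x) l (conjV l) ha2 hb2
      (tendsto_flow k (conjV k) ha1 hb1 tendsto_const_nhds)
    have h2 := tendsto_smul_flow_sub (x := x) k (conjV k) ha2 hb2 tendsto_const_nhds
    have h3 : β • D x = (β * dot (conjV l) x) • l + (-β * dot l x) • conjV l +
        ((β * dot (conjV k) x) • k + (-β * dot k x) • conjV k) := by simp only [hD]; module
    rw [h3]
    refine (h1.add h2).congr' (hmem.mono fun z hz => ?_)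
    simp only [hg z hz x, ha, hb]; module
  refine cross_eq_of_derivation (D := D) (fun x => rfl) fun x y => ?_
  have hL := hg2 (imMul x y)
  have hR : Tendsto (fun z => imMul (z • (g z x - x)) (g z y) + imMul x (z • (g z y - y))) F
      (𝓝 (imMul (β • D x) y + imMul x (β • D y))) :=
    (tendsto_imMul (hg2 x) (hg1 y)).add (tendsto_imMul tendsto_const_nhds (hg2 y))
  -- Multiplicativity of g, rearranged as a difference quotient; its limit is the Leibniz rule for
  -- D.
  have hEq : (fun z => z • (g z (imMul x y) - imMul x y)) =ᶠ[F]
      fun z => imMul (z • (g z x - x)) (g z y) + imMul x (z • (g z y - y)) := by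
    filter_upwards [hmem] with z hz
    rw [← hgG z hz]
    simp only [imMul_smul_left, imMul_smul_right, imMul_sub_left, imMul_sub_right]
    module
  have h := tendsto_nhds_unique (hL.congr' hEq) hR
  rw [imMul_smul_left, imMul_smul_right, ← smul_add] at h
  exact smul_right_injective V hβ0 h

/-- If the product of two simple factors takes values in `𝔾₂`, the cross products agree. -/
lemma NullPair.cross_eq_of_inG2 {α : ℂ} (hα : α.im ≠ 0) {l k : V} (hl : NullPair l (conjV l))
    (hk : NullPair k (conjV k)) {U : Set ℂ} (hU : Dense U)
    (hG : ∀ z ∈ U, InG2 (simpleFactor α (ℂ ∙ l) z * simpleFactor α (ℂ ∙ k) z)) :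
    imMul l (conjV l) = imMul (conjV k) k := by
  refine cross_eq_of_imMul_flow_flow hα hU
    (g := fun z x => (simpleFactor α (ℂ ∙ l) z * simpleFactor α (ℂ ∙ k) z) x)
    (fun z _ x => ?_) fun z hz x y => ((hG z hz).dot_imMul_eq x y).2
  rw [mul_apply_eq_comp, hl.simpleFactor_span, hk.simpleFactor_span]

/-- A single simple factor does not take values in `𝔾₂`. -/
lemma NullPair.exists_not_inG2 {α : ℂ} (hα : α.im ≠ 0) {l : V} (hl : NullPair l (conjV l))
    {U : Set ℂ} (hU : Dense U) : ∃ z ∈ U, ¬ InG2 (simpleFactor α (ℂ ∙ l) z) := by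
  by_contra! hG
  -- For k = 0 the second flow is the identity, so l · l̄ would vanish, although its square under
  -- `dot` is -1.
  have h := cross_eq_of_imMul_flow_flow hα (l := l) (k := 0) hU
    (g := fun z x => simpleFactor α (ℂ ∙ l) z x)
    (fun z _ x => by rw [hl.simpleFactor_span]; simp [flow])
    fun z hz x y => ((hG z hz).dot_imMul_eq x y).2
  have h1 := hl.cross_dot_cross
  simp [h] at h1

/-! ### Loops with two simple poles -/

lemma zero_smul_op (A : V →L[ℂ] V) : (0 : ℂ) • A = 0 := by module

lemma smul_zero_op (c : ℂ) : c • (0 : V →L[ℂ] V) = 0 := by module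

lemma sub_conj_ne_zero {α : ℂ} (hα : α.im ≠ 0) : α - starRingEnd ℂ α ≠ 0 := by
  intro h
  apply hα
  have := congrArg Complex.im h
  simp at this
  linarith

lemma isOpen_dense_compl_pair (a b : ℂ) :
    IsOpen ({a, b}ᶜ : Set ℂ) ∧ Dense ({a, b}ᶜ : Set ℂ) := by
  have hf : ({a, b} : Set ℂ).Finite := Set.toFinite _
  exact ⟨hf.isClosed.isOpen_compl, hf.countable.dense_compl ℂ⟩

lemma eventually_nhdsNE_notMem_pair (a b x : ℂ) : ∀ᶠ z in 𝓝[≠] x, z ∈ ({a, b}ᶜ : Set ℂ) := by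
  have hf : (({a, b} : Set ℂ) \ {x}).Finite := (Set.toFinite _).subset Set.sdiff_subset
  have h1 : ∀ᶠ z in 𝓝[≠] x, z ∈ (({a, b} : Set ℂ) \ {x})ᶜ :=
    nhdsWithin_le_nhds (hf.isClosed.isOpen_compl.mem_nhds (by simp))
  filter_upwards [h1, self_mem_nhdsWithin] with z hz hzx h
  exact hz ⟨h, hzx⟩

/-- The rational function `1 + A/(z-α) + B/(z-ᾱ)`. -/
def twoPole (α : ℂ) (A B : V →L[ℂ] V) (z : ℂ) : V →L[ℂ] V :=
  1 + (z - α)⁻¹ • A + (z - starRingEnd ℂ α)⁻¹ • B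

section TwoPole

variable {α : ℂ} {A B : V →L[ℂ] V} {g : ℂ → V →L[ℂ] V}

lemma analyticAt_twoPole {z : ℂ} (h1 : z ≠ α) (h2 : z ≠ starRingEnd ℂ α) :
    AnalyticAt ℂ (twoPole α A B) z := by
  have e1 : z - α ≠ 0 := sub_ne_zero.mpr h1
  have e2 : z - starRingEnd ℂ α ≠ 0 := sub_ne_zero.mpr h2
  unfold twoPole
  fun_prop (disch := assumption)

lemma meromorphicAt_twoPole (z : ℂ) : MeromorphicAt (twoPole α A B) z := by
  unfold twoPole
  fun_prop

lemma meromorphicOrderAt_eq_neg_one_left (hα : α.im ≠ 0)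
    (hg : g =ᶠ[𝓝[≠] α] twoPole α A B) : meromorphicOrderAt g α = -1 ↔ A ≠ 0 := by
  have hβ := sub_conj_ne_zero hα
  rw [meromorphicOrderAt_congr hg]
  constructor
  · rintro h rfl
    have : AnalyticAt ℂ (fun z => (1 : V →L[ℂ] V) + (z - starRingEnd ℂ α)⁻¹ • B) α := by
      fun_prop (disch := assumption)
    have h0 := this.meromorphicOrderAt_nonneg
    have e : (fun z => (1 : V →L[ℂ] V) + (z - starRingEnd ℂ α)⁻¹ • B) = twoPole α 0 B := by
      funext z; rw [twoPole, smul_zero_op, add_zero]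
    rw [e, h] at h0
    exact absurd h0 (by decide)
  · intro hA
    refine (meromorphicOrderAt_eq_int_iff (n := -1) (meromorphicAt_twoPole α)).mpr
      ⟨fun z => A + (z - α) • ((1 : V →L[ℂ] V) + (z - starRingEnd ℂ α)⁻¹ • B), ?_, ?_, ?_⟩
    · fun_prop (disch := assumption)
    · simpa [zero_smul_op] using hA
    · filter_upwards [self_mem_nhdsWithin] with z hz
      have : z - α ≠ 0 := sub_ne_zero.mpr hz
      rw [twoPole, smul_add, smul_smul, zpow_neg_one, inv_mul_cancel₀ this, one_smul]
      abel

lemma twoPole_swap (α : ℂ) (A B : V →L[ℂ] V) :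
    twoPole α A B = twoPole (starRingEnd ℂ α) B A := by
  funext z; simp only [twoPole, Complex.conj_conj]; abel

lemma meromorphicOrderAt_eq_neg_one_right (hα : α.im ≠ 0)
    (hg : g =ᶠ[𝓝[≠] starRingEnd ℂ α] twoPole α A B) :
    meromorphicOrderAt g (starRingEnd ℂ α) = -1 ↔ B ≠ 0 := by
  rw [twoPole_swap] at hg
  exact meromorphicOrderAt_eq_neg_one_left (by simpa using hα) hg

lemma eventuallyEq_twoPole (hg : ∀ z ∈ ({α, starRingEnd ℂ α}ᶜ : Set ℂ), g z = twoPole α A B z)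
    (x : ℂ) : g =ᶠ[𝓝[≠] x] twoPole α A B := by
  filter_upwards [eventually_nhdsNE_notMem_pair α (starRingEnd ℂ α) x] with z hz using hg z hz

lemma onlySimplePoles_of_eq_twoPole (hα : α.im ≠ 0)
    (hg : ∀ z ∈ ({α, starRingEnd ℂ α}ᶜ : Set ℂ), g z = twoPole α A B z) (hA : A ≠ 0) (hB : B ≠ 0) :
    OnlySimplePoles g α := by
  refine ⟨(meromorphicOrderAt_eq_neg_one_left hα (eventuallyEq_twoPole hg _)).mpr hA,
    (meromorphicOrderAt_eq_neg_one_right hα (eventuallyEq_twoPole hg _)).mpr hB, ?_⟩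
  intro z h1 h2
  rw [meromorphicOrderAt_congr (eventuallyEq_twoPole hg z)]
  exact (analyticAt_twoPole h1 h2).meromorphicOrderAt_nonneg

lemma isNegRealG2Loop_of_eq_twoPole
    (hg : ∀ z ∈ ({α, starRingEnd ℂ α}ᶜ : Set ℂ), g z = twoPole α A B z)
    (hG : ∀ z ∈ ({α, starRingEnd ℂ α}ᶜ : Set ℂ), InG2 (g z))
    (hr : ∀ z v, conjV (g ((starRingEnd ℂ) z) (conjV v)) = g z v) :
    IsNegRealG2Loop g := by
  have hU := isOpen_dense_compl_pair α (starRingEnd ℂ α)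
  -- The expansion at infinity: for z = 1/w one has (z - c)⁻¹ = w / (1 - c w).
  set h : ℂ → V →L[ℂ] V := fun w => 1 + (w / (1 - α * w)) • A
    + (w / (1 - starRingEnd ℂ α * w)) • B with hh
  have han : AnalyticAt ℂ h 0 := by
    have e1 : 1 - α * 0 ≠ 0 := by simp
    have e2 : 1 - starRingEnd ℂ α * 0 ≠ 0 := by simp
    rw [hh]
    fun_prop (disch := assumption)
  have heq : ∀ᶠ w in 𝓝[≠] (0 : ℂ), g w⁻¹ = h w := by
    filter_upwards [self_mem_nhdsWithin,
      eventually_nhdsNE_notMem_pair α⁻¹ (starRingEnd ℂ α)⁻¹ 0] with w hw hw2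
    have hw0 : w ≠ 0 := hw
    have hmem : w⁻¹ ∈ ({α, starRingEnd ℂ α}ᶜ : Set ℂ) := by
      simp only [Set.mem_compl_iff, Set.mem_insert_iff, Set.mem_singleton_iff, not_or] at hw2 ⊢
      exact ⟨fun h => hw2.1 (by rw [← h, inv_inv]), fun h => hw2.2 (by rw [← h, inv_inv])⟩
    have e : ∀ c : ℂ, (w⁻¹ - c)⁻¹ = w / (1 - c * w) := by
      intro c
      have : w⁻¹ - c = w⁻¹ * (1 - c * w) := by field_simp
      rw [this, mul_inv, inv_inv, div_eq_mul_inv]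
    rw [hg _ hmem, twoPole, e, e]
  refine ⟨⟨⟨_, hU.1, hU.2, ?_, hG⟩, ?_, ?_⟩, ⟨Set.univ, isOpen_univ, dense_univ,
    fun z _ v => hr z v⟩, ⟨h, han, ?_, heq⟩⟩
  · intro z hz
    have hz' : z ≠ α ∧ z ≠ starRingEnd ℂ α := by simpa using hz
    exact ((analyticAt_twoPole hz'.1 hz'.2).differentiableAt.differentiableWithinAt).congr hg
      (hg z hz)
  · intro z
    exact (meromorphicAt_twoPole z).congr (eventuallyEq_twoPole hg z).symm
  · exact han.meromorphicAt.congr (heq.mono fun w hw => hw.symm)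
  · simp only [hh, zero_div]
    rw [zero_smul_op, zero_smul_op, add_zero, add_zero]; rfl

/-- Coefficients of a partial fraction expansion are determined on a dense set. -/
lemma twoPole_injective (hα : α.im ≠ 0) {A' B' : V →L[ℂ] V} {U : Set ℂ} (hU : Dense U)
    (hUα : U ⊆ {α, starRingEnd ℂ α}ᶜ) (h : ∀ z ∈ U, twoPole α A B z = twoPole α A' B' z) :
    A = A' ∧ B = B' := by
  have hβ := sub_conj_ne_zero hα
  -- After clearing denominators the difference is continuous, so it vanishes at the poles too,
  -- where each value isolates one coefficient.
  have key : (fun z : ℂ => (z - starRingEnd ℂ α) • (A - A') + (z - α) • (B - B')) = fun _ => 0 := by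
    refine Continuous.ext_on hU (by fun_prop) (by fun_prop) fun z hz => ?_
    have hz' : z ≠ α ∧ z ≠ starRingEnd ℂ α := by simpa using hUα hz
    have e1 : z - α ≠ 0 := sub_ne_zero.mpr hz'.1
    have e2 : z - starRingEnd ℂ α ≠ 0 := sub_ne_zero.mpr hz'.2
    have e := congrArg (fun T => ((z - α) * (z - starRingEnd ℂ α)) • T) (h z hz)
    simp only [twoPole, smul_add, smul_smul] at e
    rw [show (z - α) * (z - starRingEnd ℂ α) * (z - α)⁻¹ = z - starRingEnd ℂ α by field_simp,
      show (z - α) * (z - starRingEnd ℂ α) * (z - starRingEnd ℂ α)⁻¹ = z - α by field_simp] at e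
    linear_combination (norm := module) e
  have k1 := congrFun key α
  have k2 := congrFun key (starRingEnd ℂ α)
  simp only [sub_self] at k1 k2
  rw [zero_smul_op, add_zero] at k1
  rw [zero_smul_op, zero_add] at k2
  refine ⟨sub_eq_zero.mp ((smul_eq_zero.mp k1).resolve_left hβ),
    sub_eq_zero.mp ((smul_eq_zero.mp k2).resolve_left fun h => hβ ?_)⟩
  rw [← neg_sub, h, neg_zero]

end TwoPole

/-! ### Products of two simple factors of lines -/

namespace NullPair

variable {l k : V} {α : ℂ}

lemma simpleFactor_eq_add (hl : NullPair l (conjV l)) {z : ℂ}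
    (hz : z ∈ ({α, starRingEnd ℂ α}ᶜ : Set ℂ)) :
    simpleFactor α (ℂ ∙ l) z = 1
      - ((α - starRingEnd ℂ α) * (z - starRingEnd ℂ α)⁻¹) • (ℂ ∙ l).starProjection
      + ((α - starRingEnd ℂ α) * (z - α)⁻¹) • (conjSub (ℂ ∙ l)).starProjection := by
  have hz' : z ≠ α ∧ z ≠ starRingEnd ℂ α := by simpa using hz
  have e1 : z - α ≠ 0 := sub_ne_zero.mpr hz'.1
  have e2 : z - starRingEnd ℂ α ≠ 0 := sub_ne_zero.mpr hz'.2
  rw [simpleFactor_eq_of_isIsotropic hl.isIsotropicLine_span.2]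
  rw [show (z - α) / (z - starRingEnd ℂ α) - 1
      = -((α - starRingEnd ℂ α) * (z - starRingEnd ℂ α)⁻¹) by field_simp; ring,
    show (z - starRingEnd ℂ α) / (z - α) - 1 = (α - starRingEnd ℂ α) * (z - α)⁻¹ by
      field_simp; ring]
  module

lemma inv_mul_inv_sub {z : ℂ} (hz : z ∈ ({α, starRingEnd ℂ α}ᶜ : Set ℂ)) :
    (α - starRingEnd ℂ α) * ((z - α)⁻¹ * (z - starRingEnd ℂ α)⁻¹) =
      (z - α)⁻¹ - (z - starRingEnd ℂ α)⁻¹ := by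
  have hz' : z ≠ α ∧ z ≠ starRingEnd ℂ α := by simpa using hz
  have e1 : z - α ≠ 0 := sub_ne_zero.mpr hz'.1
  have e2 : z - starRingEnd ℂ α ≠ 0 := sub_ne_zero.mpr hz'.2
  field_simp
  ring

/-- Partial fractions of the product of two simple factors. -/
lemma simpleFactor_mul_simpleFactor (hl : NullPair l (conjV l))
    (hk : NullPair k (conjV k)) (h0 : dot (conjV l) k = 0) {z : ℂ}
    (hz : z ∈ ({α, starRingEnd ℂ α}ᶜ : Set ℂ)) :
    simpleFactor α (ℂ ∙ l) z * simpleFactor α (ℂ ∙ k) z = twoPole α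
      ((α - starRingEnd ℂ α) • ((conjSub (ℂ ∙ l)).starProjection + (conjSub (ℂ ∙ k)).starProjection
        - (conjSub (ℂ ∙ l)).starProjection * (ℂ ∙ k).starProjection
        - (ℂ ∙ l).starProjection * (conjSub (ℂ ∙ k)).starProjection))
      (-(α - starRingEnd ℂ α) • ((ℂ ∙ l).starProjection + (ℂ ∙ k).starProjection
        - (conjSub (ℂ ∙ l)).starProjection * (ℂ ∙ k).starProjection
        - (ℂ ∙ l).starProjection * (conjSub (ℂ ∙ k)).starProjection)) z := by
  have hPS : (ℂ ∙ l).starProjection * (ℂ ∙ k).starProjection = 0 := by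
    ext1 x
    simp [hl.starProjection_span, hk.starProjection_span, h0]
  have h0' : dot l (conjV k) = 0 := by
    rw [← conjV_conjV l, dot_conjV_conjV, h0, map_zero]
  have hQT : (conjSub (ℂ ∙ l)).starProjection * (conjSub (ℂ ∙ k)).starProjection = 0 := by
    ext1 x
    simp [hl.starProjection_conjSub_span, hk.starProjection_conjSub_span, h0']
  have hw := inv_mul_inv_sub hz
  rw [hl.simpleFactor_eq_add hz, hk.simpleFactor_eq_add hz, twoPole]
  generalize (ℂ ∙ l).starProjection = P at *
  generalize (ℂ ∙ k).starProjection = S at *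
  generalize (conjSub (ℂ ∙ l)).starProjection = Q at *
  generalize (conjSub (ℂ ∙ k)).starProjection = T at *
  generalize (z - α)⁻¹ = w at *
  generalize (z - starRingEnd ℂ α)⁻¹ = w' at *
  generalize α - starRingEnd ℂ α = β at *
  simp only [mul_add, add_mul, mul_sub, sub_mul, one_mul, mul_one, smul_mul_assoc, mul_smul_comm,
    hPS, hQT]
  linear_combination (norm := module) -(β * hw) • (Q * S) - (β * hw) • (P * T)

lemma conjV_flow (l x : V) (a b : ℂ) : conjV (flow l (conjV l) a b (conjV x)) =
    flow l (conjV l) (starRingEnd ℂ b) (starRingEnd ℂ a) x := by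
  have h1 : starRingEnd ℂ (dot (conjV l) (conjV x)) = dot l x := by
    rw [dot_conjV_conjV, Complex.conj_conj]
  have h2 : starRingEnd ℂ (dot l (conjV x)) = dot (conjV l) x := by
    rw [← dot_conjV_conjV, conjV_conjV]
  simp only [flow, conjV_add, conjV_smul, conjV_conjV, map_mul, map_sub, map_one, h1, h2]
  module

lemma conjV_simpleFactor (hl : NullPair l (conjV l)) (z : ℂ) (x : V) :
    conjV (simpleFactor α (ℂ ∙ l) (starRingEnd ℂ z) (conjV x)) = simpleFactor α (ℂ ∙ l) z x := by
  rw [hl.simpleFactor_span, hl.simpleFactor_span, conjV_flow]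
  simp

lemma div_mul_div_conj {z : ℂ} (hz : z ∈ ({α, starRingEnd ℂ α}ᶜ : Set ℂ)) :
    (z - α) / (z - starRingEnd ℂ α) * ((z - starRingEnd ℂ α) / (z - α)) = 1 := by
  have hz' : z ≠ α ∧ z ≠ starRingEnd ℂ α := by simpa using hz
  have e1 : z - α ≠ 0 := sub_ne_zero.mpr hz'.1
  have e2 : z - starRingEnd ℂ α ≠ 0 := sub_ne_zero.mpr hz'.2
  field_simp

/-- The simple factor of the conjugate line is the inverse. -/
lemma simpleFactor_mul_conjSub (hl : NullPair l (conjV l)) {z : ℂ}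
    (hz : z ∈ ({α, starRingEnd ℂ α}ᶜ : Set ℂ)) :
    simpleFactor α (ℂ ∙ l) z * simpleFactor α (conjSub (ℂ ∙ l)) z = 1 := by
  ext1 x
  rw [conjSub_span_singleton, mul_apply_eq_comp, hl.simpleFactor_span, hl.conj.simpleFactor_span,
    conjV_conjV, flow_swap (conjV l) l]
  exact hl.flow_flow (div_mul_div_conj hz) x

lemma simpleFactor_conjSub_mul (hl : NullPair l (conjV l)) {z : ℂ}
    (hz : z ∈ ({α, starRingEnd ℂ α}ᶜ : Set ℂ)) :
    simpleFactor α (conjSub (ℂ ∙ l)) z * simpleFactor α (ℂ ∙ l) z = 1 := by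
  have := hl.conj.simpleFactor_mul_conjSub hz
  rwa [← conjSub_span_singleton, conjSub_conjSub] at this

lemma inG2_simpleFactor_mul (hl : NullPair l (conjV l)) (hk : NullPair k (conjV k))
    (hw : imMul l (conjV l) = imMul (conjV k) k) {z : ℂ}
    (hz : z ∈ ({α, starRingEnd ℂ α}ᶜ : Set ℂ)) :
    InG2 (simpleFactor α (ℂ ∙ l) z * simpleFactor α (ℂ ∙ k) z) := by
  have hab := div_mul_div_conj hz
  have e1 := hl.simpleFactor_mul_conjSub hz
  have e2 := hl.simpleFactor_conjSub_mul hz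
  have e3 := hk.simpleFactor_mul_conjSub hz
  have e4 := hk.simpleFactor_conjSub_mul hz
  refine inG2_of_imMul (B := simpleFactor α (conjSub (ℂ ∙ k)) z * simpleFactor α (conjSub (ℂ ∙ l)) z)
    (fun x => ?_) (fun x => ?_) (fun x y => ?_) (fun x y => ?_)
  · rw [← mul_apply_eq_comp, mul_assoc, ← mul_assoc (simpleFactor α (ℂ ∙ k) z), e3, one_mul, e1]
    rfl
  · rw [← mul_apply_eq_comp, mul_assoc, ← mul_assoc (simpleFactor α (conjSub (ℂ ∙ l)) z), e2,
      one_mul, e4]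
    rfl
  · simp only [mul_apply_eq_comp, hl.simpleFactor_span, hk.simpleFactor_span]
    rw [hl.dot_flow_flow hab, hk.dot_flow_flow hab]
  · simp only [mul_apply_eq_comp, hl.simpleFactor_span, hk.simpleFactor_span]
    -- Read along the pair k̄, k, the second flow has the inverse parameters, and this pair has the
    -- same cross product as l, l̄.
    rw [flow_swap k]
    exact hl.imMul_flow_flow hk.symm hw hab x y

theorem isNegRealG2Loop (hl : NullPair l (conjV l)) (hk : NullPair k (conjV k))
    (hp : PairCondition (ℂ ∙ l) (ℂ ∙ k)) :
    IsNegRealG2Loop (fun z => simpleFactor α (ℂ ∙ l) z * simpleFactor α (ℂ ∙ k) z) := by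
  have h0 := span_le_perp_conjSub.mp hp.1
  refine isNegRealG2Loop_of_eq_twoPole
    (fun z hz => hl.simpleFactor_mul_simpleFactor hk h0 hz)
    (fun z hz => hl.inG2_simpleFactor_mul hk ((hl.pairCondition_iff hk).mp hp).2 hz)
    (fun z v => ?_)
  simp only [mul_apply_eq_comp]
  rw [← hk.conjV_simpleFactor z v, ← hl.conjV_simpleFactor z, conjV_conjV]

theorem onlySimplePoles (hα : α.im ≠ 0) (hl : NullPair l (conjV l)) (hk : NullPair k (conjV k))
    (hp : PairCondition (ℂ ∙ l) (ℂ ∙ k)) :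
    OnlySimplePoles (fun z => simpleFactor α (ℂ ∙ l) z * simpleFactor α (ℂ ∙ k) z) α := by
  have h0 := span_le_perp_conjSub.mp hp.1
  have h0' : dot l (conjV k) = 0 := by
    rw [← conjV_conjV l, dot_conjV_conjV, h0, map_zero]
  have hβ := sub_conj_ne_zero hα
  have hne := ((hl.pairCondition_iff hk).mp hp).1
  have hnot : ∀ c : ℂ, k ≠ c • conjV l := by
    rintro c rfl
    refine hne ?_
    have hc : c ≠ 0 := by rintro rfl; exact hk.ne_zero (by simp)
    rw [conjSub_span_singleton]
    exact Submodule.span_singleton_smul_eq hc.isUnit _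
  refine onlySimplePoles_of_eq_twoPole hα
    (fun z hz => hl.simpleFactor_mul_simpleFactor hk h0 hz) (fun h => ?_) (fun h => ?_)
  -- Up to a nonzero factor, the residue at α sends k̄ to k̄ - ⟨l̄, k̄⟩ l; its vanishing would put k
  -- in L̄. The residue at ᾱ is tested on k in the same way.
  · have h1 := congrArg (fun T : V →L[ℂ] V => T (conjV k)) ((smul_eq_zero.mp h).resolve_left hβ)
    simp [hl.starProjection_span, hk.starProjection_span, hl.starProjection_conjSub_span,
      hk.starProjection_conjSub_span, h0', hk.pairing, hk.right] at h1
    refine hnot (starRingEnd ℂ (dot (conjV l) (conjV k))) ?_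
    rw [← conjV_smul, ← sub_eq_zero.mp h1, conjV_conjV]
  · have h1 := congrArg (fun T : V →L[ℂ] V => T k)
      ((smul_eq_zero.mp h).resolve_left (neg_ne_zero.mpr hβ))
    simp [hl.starProjection_span, hk.starProjection_span, hl.starProjection_conjSub_span,
      hk.starProjection_conjSub_span, h0, hk.pairing', hk.left] at h1
    exact hnot _ (sub_eq_zero.mp h1)

end NullPair

/-! ### Partial fractions of a loop with two simple poles -/

/-- Each point of the open exterior of a disc is a limit of points of S in that exterior, and closed
balls around y have closed preimages. -/
lemma tendsto_cobounded_of_dense {E : Type*} [NormedAddCommGroup E] {f : ℂ → E}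
    (hf : Continuous f) {S : Set ℂ} (hS : Dense S) {y : E}
    (h : Tendsto f (Bornology.cobounded ℂ ⊓ 𝓟 S) (𝓝 y)) :
    Tendsto f (Bornology.cobounded ℂ) (𝓝 y) := by
  rw [(Metric.nhds_basis_closedBall (x := y)).tendsto_right_iff]
  intro ε hε
  have h1 := h (Metric.closedBall_mem_nhds y hε)
  rw [mem_map, mem_inf_principal, (Metric.hasBasis_cobounded_compl_closedBall (0 : ℂ)).mem_iff] at h1
  obtain ⟨R, -, hR⟩ := h1
  refine (Metric.hasBasis_cobounded_compl_closedBall (0 : ℂ)).mem_iff.mpr ⟨R, trivial, ?_⟩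
  intro z hz
  have hcl := hS.open_subset_closure_inter Metric.isClosed_closedBall.isOpen_compl hz
  exact closure_minimal (fun w hw => hR hw.1 hw.2) (Metric.isClosed_closedBall.preimage hf) hcl

lemma isOpen_dense_of_eventually_nhdsNE {p : ℂ → Prop} (h : ∀ x, ∀ᶠ z in 𝓝[≠] x, p z) :
    IsOpen {z | p z} ∧ Dense {z | p z} := by
  have hc : {z | p z} ∈ codiscrete ℂ := by
    rw [mem_codiscrete]
    intro x
    rw [Filter.disjoint_principal_right, compl_compl]
    exact h x
  refine ⟨(mem_codiscrete'.mp hc).1, fun x => ?_⟩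
  rw [mem_closure_iff_frequently]
  exact (h x).frequently.filter_mono nhdsWithin_le_nhds

/-- Multiplication by (z - α)(z - ᾱ) removes the poles, leaving an entire function. Its second
divided difference is entire and tends to 1 at infinity, hence is 1 by Liouville's theorem. -/
theorem exists_eq_twoPole {α : ℂ} (hα : α.im ≠ 0) {g : ℂ → V →L[ℂ] V}
    (hm : ∀ z, MeromorphicAt g z) (hp : OnlySimplePoles g α)
    (hn : ∃ h : ℂ → V →L[ℂ] V, AnalyticAt ℂ h 0 ∧ h 0 = ContinuousLinearMap.id ℂ V ∧
      ∀ᶠ w in 𝓝[≠] (0 : ℂ), g w⁻¹ = h w) :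
    ∃ A B : V →L[ℂ] V, ∀ x, g =ᶠ[𝓝[≠] x] twoPole α A B := by
  have hβ := sub_conj_ne_zero hα
  set α' := starRingEnd ℂ α with hα'
  set F : ℂ → V →L[ℂ] V := (fun z => z - α) • ((fun z => z - α') • g) with hF
  have m1 : ∀ c x : ℂ, AnalyticAt ℂ (fun z : ℂ => z - c) x := fun c x => by fun_prop
  have hFm : ∀ x, MeromorphicAt F x := fun x =>
    (m1 _ x).meromorphicAt.smul ((m1 _ x).meromorphicAt.smul (hm x))
  have hFo : ∀ x, 0 ≤ meromorphicOrderAt F x := by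
    intro x
    rw [hF, meromorphicOrderAt_smul (m1 _ x).meromorphicAt
      ((m1 _ x).meromorphicAt.smul (hm x)), meromorphicOrderAt_smul (m1 _ x).meromorphicAt (hm x)]
    have n1 := (m1 α x).meromorphicOrderAt_nonneg
    have n2 := (m1 α' x).meromorphicOrderAt_nonneg
    have o1 : ∀ c : ℂ, meromorphicOrderAt (fun z : ℂ => z - c) c = 1 := by
      intro c
      exact meromorphicOrderAt_id_sub_const
    obtain ⟨p1, p2, p3⟩ := hp
    by_cases h1 : x = α
    · subst h1
      rw [p1, o1]
      have : (1 : WithTop ℤ) + (meromorphicOrderAt (fun z : ℂ => z - α') x + -1)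
          = meromorphicOrderAt (fun z : ℂ => z - α') x + (1 + -1) := by
        rw [add_left_comm]
      rw [this, show (1 : WithTop ℤ) + -1 = 0 from rfl, add_zero]
      exact n2
    · by_cases h2 : x = α'
      · subst h2
        rw [p2, o1, show (1 : WithTop ℤ) + -1 = 0 from rfl, add_zero]
        exact n1
      · exact add_nonneg n1 (add_nonneg n2 (p3 x h1 h2))
  -- The normal form resets the values at isolated points, where F may have removable singularities.
  set E := toMeromorphicNFOn F Set.univ with hE
  have hFon : MeromorphicOn F Set.univ := fun x _ => hFm x
  have hEan : ∀ x, AnalyticAt ℂ E x := by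
    intro x
    have hnf : MeromorphicNFAt E x := meromorphicNFOn_toMeromorphicNFOn F Set.univ (Set.mem_univ x)
    rw [← hnf.meromorphicOrderAt_nonneg_iff_analyticAt,
      meromorphicOrderAt_toMeromorphicNFOn hFon (Set.mem_univ x)]
    exact hFo x
  have hEF : ∀ x, F =ᶠ[𝓝[≠] x] E := fun x =>
    (hFon.toMeromorphicNFOn_eq_self_on_nhdsNE (Set.mem_univ x)).symm
  have hEd : Differentiable ℂ E := fun x => (hEan x).differentiableAt
  set E₁ := dslope E α with hE₁
  have hE₁d : Differentiable ℂ E₁ := by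
    rw [← differentiableOn_univ] at hEd ⊢
    exact (Complex.differentiableOn_dslope univ_mem).mpr hEd
  set E₂ := dslope E₁ α' with hE₂
  have hE₂d : Differentiable ℂ E₂ := by
    rw [← differentiableOn_univ] at hE₁d ⊢
    exact (Complex.differentiableOn_dslope univ_mem).mpr hE₁d
  have hexp : ∀ z, E z = E α + (z - α) • (E₁ α' + (z - α') • E₂ z) := by
    intro z
    have e1 := sub_smul_dslope E α z
    have e2 := sub_smul_dslope E₁ α' z
    rw [hE₂, e2, add_sub_cancel, hE₁, e1, add_sub_cancel]
  have hFg : ∀ z, z ≠ α → z ≠ α' → F z = E z →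
      g z = ((z - α)⁻¹ * (z - α')⁻¹) • E α + (z - α')⁻¹ • E₁ α' + E₂ z := by
    intro z h1 h2 h
    have e1 : z - α ≠ 0 := sub_ne_zero.mpr h1
    have e2 : z - α' ≠ 0 := sub_ne_zero.mpr h2
    rw [hexp z] at h
    have h' : ((z - α) * (z - α')) • g z = E α + (z - α) • (E₁ α' + (z - α') • E₂ z) := by
      rw [← h, mul_smul]; rfl
    have h3 := congrArg (fun T => ((z - α)⁻¹ * (z - α')⁻¹) • T) h'
    simp only [smul_add, smul_smul] at h3
    rw [show (z - α)⁻¹ * (z - α')⁻¹ * ((z - α) * (z - α')) = 1 by field_simp, one_smul,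
      show (z - α)⁻¹ * (z - α')⁻¹ * (z - α) = (z - α')⁻¹ by field_simp] at h3
    rw [h3]; module
  have hS := isOpen_dense_of_eventually_nhdsNE (p := fun z => z ∈ ({α, α'}ᶜ : Set ℂ) ∧ F z = E z)
    fun x => (eventually_nhdsNE_notMem_pair α α' x).and (hEF x)
  have hE₂1 : ∀ z, E₂ z = 1 := by
    obtain ⟨h, han, h0, heq⟩ := hn
    intro z
    refine hE₂d.apply_eq_of_tendsto_cocompact z ?_
    rw [← Metric.cobounded_eq_cocompact]
    refine tendsto_cobounded_of_dense hE₂d.continuous hS.2 ?_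
    have t1 : Tendsto (fun z => h z⁻¹) (Bornology.cobounded ℂ) (𝓝 1) := by
      have : Tendsto h (𝓝 0) (𝓝 1) := by
        have := han.continuousAt.tendsto
        rwa [h0] at this
      exact this.comp tendsto_inv₀_cobounded
    have t2 : Tendsto (fun z => h z⁻¹ - ((z - α)⁻¹ * (z - α')⁻¹) • E α - (z - α')⁻¹ • E₁ α')
        (Bornology.cobounded ℂ) (𝓝 (1 - ((0 : ℂ) * 0) • E α - (0 : ℂ) • E₁ α')) :=
      (t1.sub (((tendsto_inv_sub_cobounded α).mul (tendsto_inv_sub_cobounded α')).smul_const _)).sub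
        ((tendsto_inv_sub_cobounded α').smul_const _)
    rw [zero_mul, zero_smul_op, zero_smul_op, sub_zero, sub_zero] at t2
    refine (t2.mono_left inf_le_left).congr' ?_
    have heq' : ∀ᶠ z in Bornology.cobounded ℂ, g z = h z⁻¹ := by
      have ht : Tendsto (fun z : ℂ => z⁻¹) (Bornology.cobounded ℂ) (𝓝[≠] 0) :=
        tendsto_inv₀_cobounded'
      filter_upwards [ht.eventually heq] with z hz
      rwa [inv_inv] at hz
    filter_upwards [mem_inf_of_right (mem_principal_self _), mem_inf_of_left heq'] with z hz hz2
    have hz1 : z ≠ α ∧ z ≠ α' := by simpa using hz.1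
    have := hFg z hz1.1 hz1.2 hz.2
    have hz3 : g z = h z⁻¹ := hz2
    rw [← hz3, this]; abel
  refine ⟨(α - α')⁻¹ • E α, E₁ α' - (α - α')⁻¹ • E α, fun x => ?_⟩
  filter_upwards [eventually_nhdsNE_notMem_pair α α' x, hEF x] with z hz hFE
  have hz1 : z ≠ α ∧ z ≠ α' := by simpa using hz
  rw [hFg z hz1.1 hz1.2 hFE, hE₂1, twoPole, ← hα']
  have hw := NullPair.inv_mul_inv_sub hz
  have hw2 : (z - α)⁻¹ * (z - α')⁻¹ = (α - α')⁻¹ * ((z - α)⁻¹ - (z - α')⁻¹) := by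
    rw [← hw, ← mul_assoc, inv_mul_cancel₀ hβ, one_mul]
  rw [hw2]
  module

/-! ### Residues of real loops -/

/-- The conjugate operator. -/
def conjOp (A : V →L[ℂ] V) : V →L[ℂ] V :=
  LinearMap.toContinuousLinearMap
    { toFun := fun x => conjV (A (conjV x))
      map_add' := fun x y => by simp
      map_smul' := fun c x => by simp }

@[simp] lemma conjOp_apply (A : V →L[ℂ] V) (x : V) : conjOp A x = conjV (A (conjV x)) := rfl

/-- Conjugation exchanges the two poles; with uniqueness of partial fractions, reality of a loop
becomes the relation `B = conjOp A`. -/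
lemma conjV_twoPole (α : ℂ) (A B : V →L[ℂ] V) (z : ℂ) (v : V) :
    conjV (twoPole α A B (starRingEnd ℂ z) (conjV v)) =
      twoPole α (conjOp B) (conjOp A) z v := by
  simp [twoPole]
  abel

lemma twoPole_zero_zero (α z : ℂ) : twoPole α 0 0 z = 1 := by
  rw [twoPole, smul_zero_op, smul_zero_op, add_zero, add_zero]

section Coefficients

variable {α : ℂ} {A B : V →L[ℂ] V} {U : Set ℂ}

lemma smul_twoPole_apply {z : ℂ} (hz : z ∈ ({α, starRingEnd ℂ α}ᶜ : Set ℂ)) (x : V) :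
    ((z - α) * (z - starRingEnd ℂ α)) • twoPole α A B z x =
      ((z - α) * (z - starRingEnd ℂ α)) • x + (z - starRingEnd ℂ α) • A x + (z - α) • B x := by
  have hz' : z ≠ α ∧ z ≠ starRingEnd ℂ α := by simpa using hz
  have e1 : z - α ≠ 0 := sub_ne_zero.mpr hz'.1
  have e2 : z - starRingEnd ℂ α ≠ 0 := sub_ne_zero.mpr hz'.2
  simp only [twoPole, add_apply, smul_apply, one_apply_eq_self, smul_add, smul_smul]
  rw [show (z - α) * (z - starRingEnd ℂ α) * (z - α)⁻¹ = z - starRingEnd ℂ α by field_simp,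
    show (z - α) * (z - starRingEnd ℂ α) * (z - starRingEnd ℂ α)⁻¹ = z - α by field_simp]

/-- With denominators cleared, the identity is polynomial in z and extends from the dense set to the
poles, where it gives relations between residues. -/
lemma dot_cleared (hU : Dense U) (hUα : U ⊆ {α, starRingEnd ℂ α}ᶜ)
    (h : ∀ z ∈ U, ∀ x y, dot (twoPole α A B z x) (twoPole α A B z y) = dot x y) (x y : V) (z : ℂ) :
    dot (((z - α) * (z - starRingEnd ℂ α)) • x + (z - starRingEnd ℂ α) • A x + (z - α) • B x)
      (((z - α) * (z - starRingEnd ℂ α)) • y + (z - starRingEnd ℂ α) • A y + (z - α) • B y) =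
    ((z - α) * (z - starRingEnd ℂ α)) ^ 2 * dot x y := by
  refine congrFun (Continuous.ext_on (f := fun z => dot (((z - α) * (z - starRingEnd ℂ α)) • x
    + (z - starRingEnd ℂ α) • A x + (z - α) • B x) (((z - α) * (z - starRingEnd ℂ α)) • y
    + (z - starRingEnd ℂ α) • A y + (z - α) • B y))
    (g := fun z => ((z - α) * (z - starRingEnd ℂ α)) ^ 2 * dot x y) hU ?_ ?_ fun z hz => ?_) z
  · simp only [dot_add_left, dot_add_right, dot_smul_left, dot_smul_right]
    fun_prop
  · fun_prop
  · simp only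
    rw [← smul_twoPole_apply (hUα hz), ← smul_twoPole_apply (hUα hz), dot_smul_left,
      dot_smul_right, h z hz]
    ring

lemma imMul_cleared (hU : Dense U) (hUα : U ⊆ {α, starRingEnd ℂ α}ᶜ)
    (h : ∀ z ∈ U, ∀ x y, imMul (twoPole α A B z x) (twoPole α A B z y) =
      twoPole α A B z (imMul x y)) (x y : V) (z : ℂ) :
    imMul (((z - α) * (z - starRingEnd ℂ α)) • x + (z - starRingEnd ℂ α) • A x + (z - α) • B x)
      (((z - α) * (z - starRingEnd ℂ α)) • y + (z - starRingEnd ℂ α) • A y + (z - α) • B y) =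
    ((z - α) * (z - starRingEnd ℂ α)) • (((z - α) * (z - starRingEnd ℂ α)) • imMul x y
      + (z - starRingEnd ℂ α) • A (imMul x y) + (z - α) • B (imMul x y)) := by
  refine congrFun (Continuous.ext_on (f := fun z => imMul (((z - α) * (z - starRingEnd ℂ α)) • x
    + (z - starRingEnd ℂ α) • A x + (z - α) • B x) (((z - α) * (z - starRingEnd ℂ α)) • y
    + (z - starRingEnd ℂ α) • A y + (z - α) • B y))
    (g := fun z => ((z - α) * (z - starRingEnd ℂ α)) • (((z - α) * (z - starRingEnd ℂ α)) •
      imMul x y + (z - starRingEnd ℂ α) • A (imMul x y) + (z - α) • B (imMul x y))) hU ?_ ?_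
    fun z hz => ?_) z
  · simp only [imMul_add_left, imMul_add_right, imMul_smul_left, imMul_smul_right]
    fun_prop
  · fun_prop
  · simp only
    rw [← smul_twoPole_apply (hUα hz), ← smul_twoPole_apply (hUα hz),
      ← smul_twoPole_apply (hUα hz), imMul_smul_left, imMul_smul_right, h z hz]

lemma dot_residue_residue (hα : α.im ≠ 0) (hU : Dense U) (hUα : U ⊆ {α, starRingEnd ℂ α}ᶜ)
    (h : ∀ z ∈ U, ∀ x y, dot (twoPole α A B z x) (twoPole α A B z y) = dot x y) (x y : V) :
    dot (A x) (A y) = 0 := by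
  have hβ := sub_conj_ne_zero hα
  have e := dot_cleared hU hUα h x y α
  simpa [hβ] using e

lemma imMul_residue_residue (hα : α.im ≠ 0) (hU : Dense U) (hUα : U ⊆ {α, starRingEnd ℂ α}ᶜ)
    (h : ∀ z ∈ U, ∀ x y, imMul (twoPole α A B z x) (twoPole α A B z y) =
      twoPole α A B z (imMul x y)) (x y : V) : imMul (A x) (A y) = 0 := by
  have hβ := sub_conj_ne_zero hα
  have e := imMul_cleared hU hUα h x y α
  simpa [hβ] using e

/-- The second coefficient of orthogonality at the pole `α`. -/
lemma dot_residue_add (hα : α.im ≠ 0) (hU : Dense U) (hUα : U ⊆ {α, starRingEnd ℂ α}ᶜ)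
    (h : ∀ z ∈ U, ∀ x y, dot (twoPole α A B z x) (twoPole α A B z y) = dot x y) (x y : V) :
    dot (A x) ((α - starRingEnd ℂ α) • y + B y) + dot ((α - starRingEnd ℂ α) • x + B x) (A y)
      = 0 := by
  have hβ := sub_conj_ne_zero hα
  have h0 := dot_residue_residue hα hU hUα h x y
  -- The cleared identity has degree at most 4 in z - α. The five-point difference formula is exact
  -- in this degree and extracts the linear coefficient, which is β times the claim.
  have e1 := dot_cleared hU hUα h x y (α + 1)
  have e2 := dot_cleared hU hUα h x y (α - 1)
  have e3 := dot_cleared hU hUα h x y (α + 2)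
  have e4 := dot_cleared hU hUα h x y (α - 2)
  simp only [dot_add_left, dot_add_right, dot_smul_left, dot_smul_right, h0] at e1 e2 e3 e4 ⊢
  refine mul_left_cancel₀ hβ ?_
  linear_combination (2 / 3) * (e1 - e2) - (1 / 12) * (e3 - e4)

end Coefficients

/-- An isotropic subspace with vanishing product is at most two-dimensional. -/
lemma finrank_le_two {N : Submodule ℂ V} (hd : IsIsotropic N)
    (hm : ∀ x ∈ N, ∀ y ∈ N, imMul x y = 0) : Module.finrank ℂ N ≤ 2 := by
  by_contra! hlt
  set e := stdOrthonormalBasis ℂ N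
  have hin : ∀ i j, dot (conjV (e i : V)) (e j : V) = if i = j then 1 else 0 := by
    intro i j
    rw [← inner_eq_dot, ← Submodule.coe_inner]
    exact orthonormal_iff_ite.mp e.orthonormal i j
  have hp : ∀ i, NullPair (e i : V) (conjV (e i : V)) := by
    intro i
    refine ⟨hd _ (e i).2 _ (e i).2, ?_, ?_⟩
    · rw [dot_conjV_conjV, hd _ (e i).2 _ (e i).2, map_zero]
    · rw [dot_comm, hin, if_pos rfl]
  -- Three cross products that are pairwise opposite all vanish, contrary to ⟨w, w⟩ = -1.
  have hc : ∀ i j, i ≠ j →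
      imMul (e i : V) (conjV (e i)) + imMul (e j : V) (conjV (e j)) = 0 := by
    intro i j hij
    exact (hp i).cross_add_cross_of_imMul_eq_zero (hp j) (hd _ (e i).2 _ (e j).2)
      (by rw [hin, if_neg hij]) (hm _ (e i).2 _ (e j).2)
  have h01 := hc ⟨0, by omega⟩ ⟨1, by omega⟩ (by simp)
  have h02 := hc ⟨0, by omega⟩ ⟨2, by omega⟩ (by simp)
  have h12 := hc ⟨1, by omega⟩ ⟨2, by omega⟩ (by simp)
  have hz : imMul (e ⟨0, by omega⟩ : V) (conjV (e ⟨0, by omega⟩)) = 0 := by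
    linear_combination (norm := module) (1 / 2 : ℂ) • (h01 + h02 - h12)
  have h1 := (hp ⟨0, by omega⟩).cross_dot_cross
  rw [hz] at h1
  simp at h1

/-! ### Splitting off a simple factor -/

lemma NullPair.conjOp_starProjection {l : V} (hl : NullPair l (conjV l)) :
    conjOp (ℂ ∙ l).starProjection = (conjSub (ℂ ∙ l)).starProjection := by
  ext1 x
  rw [conjOp_apply, hl.starProjection_span, hl.starProjection_conjSub_span, conjV_smul,
    dot_conjV_conjV, Complex.conj_conj]

lemma conjOp_conjOp (A : V →L[ℂ] V) : conjOp (conjOp A) = A := by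
  ext1 x; simp

lemma conjOp_residue (β : ℂ) (P A B Q : V →L[ℂ] V) (hβ : starRingEnd ℂ β = -β) :
    conjOp (A + β • P + P * B - Q * A) = conjOp A - β • conjOp P + conjOp P * conjOp B
      - conjOp Q * conjOp A := by
  ext1 x
  simp only [conjOp_apply, add_apply, sub_apply, smul_apply, mul_apply_eq_comp, conjV_add,
    conjV_sub, conjV_smul, hβ, conjV_conjV]
  module

/-- A real orthogonal loop with simple poles is the product of a simple factor and a loop of the
same kind whose residue has a larger kernel. -/
theorem exists_split {α : ℂ} (hα : α.im ≠ 0) {A : V →L[ℂ] V}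
    (h : ∀ z ∈ ({α, starRingEnd ℂ α}ᶜ : Set ℂ), ∀ x y,
      dot (twoPole α A (conjOp A) z x) (twoPole α A (conjOp A) z y) = dot x y)
    {x₀ : V} (hx₀ : A x₀ ≠ 0) :
    ∃ (l : V) (R : V →L[ℂ] V), NullPair l (conjV l) ∧
      (∀ z ∈ ({α, starRingEnd ℂ α}ᶜ : Set ℂ), twoPole α A (conjOp A) z =
        simpleFactor α (ℂ ∙ l) z * twoPole α R (conjOp R) z) ∧
      (∀ z ∈ ({α, starRingEnd ℂ α}ᶜ : Set ℂ), ∀ x y,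
        dot (twoPole α R (conjOp R) z x) (twoPole α R (conjOp R) z y) = dot x y) ∧
      (∀ y, A y = 0 → R y = 0) ∧ R x₀ = 0 := by
  have hU := (isOpen_dense_compl_pair α (starRingEnd ℂ α)).2
  have d0 := dot_residue_residue hα hU subset_rfl h
  have d1 := dot_residue_add hα hU subset_rfl h
  -- L is chosen so that L̄ is spanned by A x₀; it is isotropic since the range of A is.
  obtain ⟨l, hl, hspan⟩ := IsIsotropicLine.exists_eq_span (L := ℂ ∙ conjV (A x₀))
    ⟨finrank_span_singleton (by simpa using hx₀), by
      intro x hx y hy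
      obtain ⟨a, rfl⟩ := Submodule.mem_span_singleton.mp hx
      obtain ⟨b, rfl⟩ := Submodule.mem_span_singleton.mp hy
      simp [dot_conjV_conjV, d0]⟩
  obtain ⟨c, hc⟩ : ∃ c : ℂ, c • A x₀ = conjV l := by
    obtain ⟨c, hc⟩ := Submodule.mem_span_singleton.mp (hspan ▸ Submodule.mem_span_singleton_self l)
    exact ⟨starRingEnd ℂ c, by rw [← hc]; simp⟩
  obtain ⟨c', hc'⟩ : ∃ c' : ℂ, A x₀ = c' • conjV l := by
    obtain ⟨c, hc⟩ := Submodule.mem_span_singleton.mp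
      (hspan ▸ Submodule.mem_span_singleton_self (conjV (A x₀)))
    exact ⟨starRingEnd ℂ c, by rw [← conjV_smul, hc, conjV_conjV]⟩
  have hlA : ∀ v, dot (conjV l) v = c * dot (A x₀) v := fun v => by rw [← hc, dot_smul_left]
  have hconjP := hl.conjOp_starProjection
  have hconjQ : conjOp (conjSub (ℂ ∙ l)).starProjection = (ℂ ∙ l).starProjection := by
    rw [← hconjP, conjOp_conjOp]
  -- These two vanishing products exclude double poles when the loop is multiplied by the factor of
  -- L̄.
  have hPA : (ℂ ∙ l).starProjection * A = 0 := by
    ext1 x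
    rw [mul_apply_eq_comp, hl.starProjection_span, hlA, d0, mul_zero, zero_smul]
    rfl
  have hQA : (conjSub (ℂ ∙ l)).starProjection * conjOp A = 0 := by
    rw [← hconjP]
    ext1 x
    have := congrArg (fun T : V →L[ℂ] V => conjV (T (conjV x))) hPA
    simpa using this
  set β := α - starRingEnd ℂ α with hβdef
  have hβc : starRingEnd ℂ β = -β := by simp [hβdef]
  -- The residue at α of the simple factor of L̄ times the loop.
  set R := A + β • (ℂ ∙ l).starProjection + (ℂ ∙ l).starProjection * conjOp A
    - (conjSub (ℂ ∙ l)).starProjection * A with hR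
  have hRc : conjOp R = conjOp A - β • (conjSub (ℂ ∙ l)).starProjection
      + (conjSub (ℂ ∙ l)).starProjection * A - (ℂ ∙ l).starProjection * conjOp A := by
    rw [hR, conjOp_residue _ _ _ _ _ hβc, hconjP, hconjQ, conjOp_conjOp]
  have hmul : ∀ z ∈ ({α, starRingEnd ℂ α}ᶜ : Set ℂ),
      simpleFactor α (conjSub (ℂ ∙ l)) z * twoPole α A (conjOp A) z =
        twoPole α R (conjOp R) z := by
    intro z hz
    have hw := NullPair.inv_mul_inv_sub hz
    have hs := hl.conj.simpleFactor_eq_add hz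
    simp only [← conjSub_span_singleton, conjSub_conjSub] at hs
    rw [hs, hRc, hR, twoPole, twoPole, ← hβdef]
    rw [← hβdef] at hw
    generalize (ℂ ∙ l).starProjection = P at *
    generalize (conjSub (ℂ ∙ l)).starProjection = Q at *
    generalize conjOp A = A' at *
    generalize (z - α)⁻¹ = w at *
    generalize (z - starRingEnd ℂ α)⁻¹ = w' at *
    simp only [mul_add, add_mul, sub_mul, one_mul, mul_one, smul_mul_assoc, mul_smul_comm,
      hPA, hQA]
    linear_combination (norm := module) hw • (P * A') - hw • (Q * A)
  refine ⟨l, R, hl, fun z hz => ?_, fun z hz x y => ?_, fun y hy => ?_, ?_⟩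
  · rw [← hmul z hz, ← mul_assoc, hl.simpleFactor_mul_conjSub hz, one_mul]
  · rw [← hmul z hz, conjSub_span_singleton]
    simp only [mul_apply_eq_comp, hl.conj.simpleFactor_span]
    rw [hl.conj.dot_flow_flow (NullPair.div_mul_div_conj hz), h z hz]
  -- On the kernel of A only the component of R along l survives, and the first-order relation with
  -- x₀ kills it.
  · have e := d1 x₀ y
    rw [hy, dot_zero_right, add_zero] at e
    have e2 : R y = (dot (conjV l) (β • y + conjOp A y)) • l := by
      simp only [hR, add_apply, sub_apply, smul_apply, mul_apply_eq_comp, hy, map_zero,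
        hl.starProjection_span, dot_add_right, dot_smul_right]
      module
    rw [e2, hlA, e, mul_zero, zero_smul]
  -- At x₀ the relation is twice ⟨A x₀, βx₀ + Āx₀⟩, so the component along l vanishes; the rest
  -- vanishes because A x₀ lies in L̄.
  · have e := d1 x₀ x₀
    rw [dot_comm (β • x₀ + conjOp A x₀)] at e
    have e1 : dot (A x₀) (β • x₀ + conjOp A x₀) = 0 := by linear_combination (1 / 2 : ℂ) * e
    have e2 : R x₀ = (dot (conjV l) (β • x₀ + conjOp A x₀)) • l + (A x₀ - dot l (A x₀) • conjV l) := by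
      simp only [hR, add_apply, sub_apply, smul_apply, mul_apply_eq_comp,
        hl.starProjection_span, hl.starProjection_conjSub_span, dot_add_right, dot_smul_right]
      module
    rw [e2, hlA, e1, mul_zero, zero_smul, hc', dot_smul_right, hl.pairing]
    module

/-! ### Factorizations -/

lemma dense_isOpen_preimage_conj {U : Set ℂ} (ho : IsOpen U) (hd : Dense U) :
    IsOpen (starRingEnd ℂ ⁻¹' U) ∧ Dense (starRingEnd ℂ ⁻¹' U) :=
  ⟨ho.preimage Complex.continuous_conj,
    hd.preimage Complex.conjCLE.toHomeomorph.isOpenMap⟩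

/-- A loop with two simple poles on an open dense set. -/
theorem exists_residue {α : ℂ} (hα : α.im ≠ 0) {g : ℂ → V →L[ℂ] V} (hg : IsNegRealG2Loop g)
    (hp : OnlySimplePoles g α) :
    ∃ A : V →L[ℂ] V, A ≠ 0 ∧ ∃ U : Set ℂ, IsOpen U ∧ Dense U ∧ U ⊆ {α, starRingEnd ℂ α}ᶜ ∧
      ∀ z ∈ U, g z = twoPole α A (conjOp A) z ∧ InG2 (g z) := by
  obtain ⟨A, B, hAB⟩ := exists_eq_twoPole hα hg.meromorphic hp hg.negative
  have hA : A ≠ 0 := (meromorphicOrderAt_eq_neg_one_left hα (hAB α)).mp hp.1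
  obtain ⟨U₀, hU₀, hU₀d, hr⟩ := hg.reality
  obtain ⟨U₁, hU₁, hU₁d, -, hG⟩ := hg.groupValued
  have hS := isOpen_dense_of_eventually_nhdsNE
    (p := fun z => z ∈ ({α, starRingEnd ℂ α}ᶜ : Set ℂ) ∧ g z = twoPole α A B z)
    fun x => (eventually_nhdsNE_notMem_pair α _ x).and (hAB x)
  set S := {z | z ∈ ({α, starRingEnd ℂ α}ᶜ : Set ℂ) ∧ g z = twoPole α A B z} with hSdef
  have hSc := dense_isOpen_preimage_conj hS.1 hS.2
  have hinj := twoPole_injective hα (A := conjOp B) (B := conjOp A) (A' := A) (B' := B)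
    (U := (U₀ ∩ S) ∩ starRingEnd ℂ ⁻¹' S)
    ((hU₀d.inter_of_isOpen_left hS.2 hU₀).inter_of_isOpen_left hSc.2 (hU₀.inter hS.1))
    (fun z hz => hz.1.2.1) (fun z hz => by
      ext1 v
      rw [← conjV_twoPole, ← hz.2.2, hr z hz.1.1, hz.1.2.2])
  refine ⟨A, hA, S ∩ U₁, hS.1.inter hU₁, hS.2.inter_of_isOpen_left hU₁d hS.1,
    fun z hz => hz.1.1, fun z hz => ⟨?_, hG z hz.2⟩⟩
  rw [hinj.2, hz.1.2]

lemma dot_twoPole_of_dense {α : ℂ} {A B : V →L[ℂ] V} {U : Set ℂ} (hU : Dense U)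
    (hUα : U ⊆ {α, starRingEnd ℂ α}ᶜ)
    (h : ∀ z ∈ U, ∀ x y, dot (twoPole α A B z x) (twoPole α A B z y) = dot x y) {z : ℂ}
    (hz : z ∈ ({α, starRingEnd ℂ α}ᶜ : Set ℂ)) (x y : V) :
    dot (twoPole α A B z x) (twoPole α A B z y) = dot x y := by
  have e := dot_cleared hU hUα h x y z
  have hz' : z ≠ α ∧ z ≠ starRingEnd ℂ α := by simpa using hz
  have e1 : (z - α) * (z - starRingEnd ℂ α) ≠ 0 :=
    mul_ne_zero (sub_ne_zero.mpr hz'.1) (sub_ne_zero.mpr hz'.2)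
  rw [← smul_twoPole_apply hz, ← smul_twoPole_apply hz, dot_smul_left, dot_smul_right,
    ← mul_assoc, ← sq] at e
  exact mul_left_cancel₀ (pow_ne_zero 2 e1) e

lemma finrank_ker_lt {A R : V →L[ℂ] V} {x₀ : V} (hx₀ : A x₀ ≠ 0) (h : ∀ y, A y = 0 → R y = 0)
    (h₀ : R x₀ = 0) : Module.finrank ℂ (LinearMap.ker (A : V →ₗ[ℂ] V)) <
      Module.finrank ℂ (LinearMap.ker (R : V →ₗ[ℂ] V)) := by
  apply Submodule.finrank_lt_finrank_of_lt
  refine lt_of_le_of_ne (fun y hy => h y hy) fun he => hx₀ ?_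
  have : x₀ ∈ LinearMap.ker (R : V →ₗ[ℂ] V) := h₀
  rw [← he] at this
  exact this

lemma simpleFactor_mul_conjSub_of_isIsotropicLine {α z : ℂ} {L : Submodule ℂ V}
    (hL : IsIsotropicLine L) (hz : z ∈ ({α, starRingEnd ℂ α}ᶜ : Set ℂ)) :
    simpleFactor α L z * simpleFactor α (conjSub L) z = 1 := by
  obtain ⟨l, hl, rfl⟩ := hL.exists_eq_span
  exact hl.simpleFactor_mul_conjSub hz

/-- Every factorization of a loop with two simple poles satisfies the pair condition. -/
theorem pairCondition_of_loopEq {α : ℂ} (hα : α.im ≠ 0) {g : ℂ → V →L[ℂ] V}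
    (hg : IsNegRealG2Loop g) (hp : OnlySimplePoles g α) {L K : Submodule ℂ V}
    (hL : IsIsotropicLine L) (hK : IsIsotropicLine K)
    (h : LoopEq g (fun z => simpleFactor α L z * simpleFactor α K z)) : PairCondition L K := by
  obtain ⟨A, hA, U, hU, hUd, hUα, hgA⟩ := exists_residue hα hg hp
  obtain ⟨U', hU', hU'd, hgLK⟩ := h
  have hd := hUd.inter_of_isOpen_left hU'd hU
  -- For K = L̄ the product is the identity, which has no residue.
  have hne : K ≠ conjSub L := by
    rintro rfl
    refine hA (twoPole_injective hα (B := conjOp A) (A' := 0) (B' := 0) hd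
      (fun z hz => hUα hz.1) fun z hz => ?_).1
    rw [← (hgA z hz.1).1, hgLK z hz.2, twoPole_zero_zero]
    exact simpleFactor_mul_conjSub_of_isIsotropicLine hL (hUα hz.1)
  obtain ⟨l, hl, rfl⟩ := hL.exists_eq_span
  obtain ⟨k, hk, rfl⟩ := hK.exists_eq_span
  refine (hl.pairCondition_iff hk).mpr ⟨hne, hl.cross_eq_of_inG2 hα hk hd fun z hz => ?_⟩
  have e : g z = simpleFactor α (ℂ ∙ l) z * simpleFactor α (ℂ ∙ k) z := hgLK z hz.2
  exact e ▸ (hgA z hz.1).2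

/-- The residue has rank at most two, and every splitting lowers its rank; so two splittings leave
the trivial loop. -/
theorem exists_factorization {α : ℂ} (hα : α.im ≠ 0) {g : ℂ → V →L[ℂ] V}
    (hg : IsNegRealG2Loop g) (hp : OnlySimplePoles g α) :
    ∃ L K : Submodule ℂ V, IsIsotropicLine L ∧ IsIsotropicLine K ∧
      LoopEq g (fun z => simpleFactor α L z * simpleFactor α K z) := by
  obtain ⟨A, hA, U, hU, hUd, hUα, hgA⟩ := exists_residue hα hg hp
  have hGA : ∀ z ∈ U, InG2 (twoPole α A (conjOp A) z) := fun z hz => by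
    rw [← (hgA z hz).1]; exact (hgA z hz).2
  have hdot : ∀ z ∈ U, ∀ x y, dot (twoPole α A (conjOp A) z x) (twoPole α A (conjOp A) z y) =
      dot x y := fun z hz x y => ((hGA z hz).dot_imMul_eq x y).1
  have hrank : Module.finrank ℂ (LinearMap.range (A : V →ₗ[ℂ] V)) ≤ 2 := by
    apply finrank_le_two
    · rintro _ ⟨x, rfl⟩ _ ⟨y, rfl⟩
      exact dot_residue_residue hα hUd hUα hdot x y
    · rintro _ ⟨x, rfl⟩ _ ⟨y, rfl⟩
      exact imMul_residue_residue hα hUd hUα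
        (fun z hz x y => ((hGA z hz).dot_imMul_eq x y).2) x y
  have hdim := LinearMap.finrank_range_add_finrank_ker (A : V →ₗ[ℂ] V)
  have hV : Module.finrank ℂ V = 7 := by simp
  obtain ⟨x₀, hx₀⟩ : ∃ x₀, A x₀ ≠ 0 := by
    by_contra! h
    exact hA (by ext1 x; exact h x)
  obtain ⟨l, R, hl, hAR, hRdot, hker, hRx₀⟩ := exists_split hα
    (fun z hz => dot_twoPole_of_dense hUd hUα hdot hz) hx₀
  have hlt := finrank_ker_lt hx₀ hker hRx₀
  -- If nothing were left after one splitting, g would be a single simple factor, which is not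
  -- 𝔾₂-valued.
  obtain ⟨x₁, hx₁⟩ : ∃ x₁, R x₁ ≠ 0 := by
    by_contra! h
    have hR0 : R = 0 := by ext1 x; exact h x
    have hR0' : conjOp R = 0 := by ext1 x; simp [h]
    obtain ⟨z, hz, hnot⟩ := hl.exists_not_inG2 hα hUd
    have e := hAR z (hUα hz)
    rw [hR0', hR0, twoPole_zero_zero, mul_one] at e
    exact hnot (e ▸ hGA z hz)
  obtain ⟨k, T, hk, hRT, -, hker', hTx₁⟩ := exists_split hα hRdot hx₁
  have hlt' := finrank_ker_lt hx₁ hker' hTx₁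
  have htop : LinearMap.ker (T : V →ₗ[ℂ] V) = ⊤ := by
    apply Submodule.eq_top_of_finrank_eq
    have := Submodule.finrank_le (LinearMap.ker (T : V →ₗ[ℂ] V))
    omega
  have hT : ∀ x, T x = 0 := fun x => by
    have : x ∈ LinearMap.ker (T : V →ₗ[ℂ] V) := htop ▸ Submodule.mem_top
    exact this
  have hT0 : T = 0 := by ext1 x; exact hT x
  have hT0' : conjOp T = 0 := by ext1 x; simp [hT]
  refine ⟨ℂ ∙ l, ℂ ∙ k, hl.isIsotropicLine_span, hk.isIsotropicLine_span, U, hU, hUd,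
    fun z hz => ?_⟩
  rw [(hgA z hz).1, hAR z (hUα hz), hRT z (hUα hz), hT0', hT0, twoPole_zero_zero, mul_one]

/-! ### Products of simple factors of lines and planes -/

lemma LoopEq.trans_of_eq {α : ℂ} {g f f' : ℂ → V →L[ℂ] V} (h : LoopEq g f)
    (hf : ∀ z ∈ ({α, starRingEnd ℂ α}ᶜ : Set ℂ), f z = f' z) : LoopEq g f' := by
  obtain ⟨U, hU, hUd, hgf⟩ := h
  have hS := isOpen_dense_compl_pair α (starRingEnd ℂ α)
  exact ⟨U ∩ _, hU.inter hS.1, hUd.inter_of_isOpen_left hS.2 hU,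
    fun z hz => (hgf z hz.1).trans (hf z hz.2)⟩

namespace NullPair

variable {l k r : V}

/-- The planes spanned by l, l̄ and by r, r̄ are orthogonal for `dot`, so each flow is trivial on
the other plane. -/
lemma simpleFactor_sup (hl : NullPair l (conjV l)) (hr : NullPair r (conjV r)) (h : dot l r = 0)
    (h' : dot (conjV l) r = 0) (α z : ℂ) :
    simpleFactor α ((ℂ ∙ l) ⊔ (ℂ ∙ r)) z =
      simpleFactor α (ℂ ∙ l) z * simpleFactor α (ℂ ∙ r) z := by
  have h1 : dot l (conjV r) = 0 := by
    rw [← conjV_conjV l, dot_conjV_conjV, h', map_zero]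
  have h2 : dot (conjV l) (conjV r) = 0 := by rw [dot_conjV_conjV, h, map_zero]
  have hiso : IsIsotropic ((ℂ ∙ l) ⊔ (ℂ ∙ r)) := by
    intro x hx y hy
    obtain ⟨_, ha, _, hb, rfl⟩ := Submodule.mem_sup.mp hx
    obtain ⟨_, hc, _, hd, rfl⟩ := Submodule.mem_sup.mp hy
    obtain ⟨a, rfl⟩ := Submodule.mem_span_singleton.mp ha
    obtain ⟨b, rfl⟩ := Submodule.mem_span_singleton.mp hb
    obtain ⟨c, rfl⟩ := Submodule.mem_span_singleton.mp hc
    obtain ⟨d, rfl⟩ := Submodule.mem_span_singleton.mp hd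
    simp [hl.left, hr.left, h, dot_comm r l]
  have ho : (ℂ ∙ l) ⟂ (ℂ ∙ r) := by
    rw [Submodule.isOrtho_span]
    rintro _ rfl _ rfl
    rw [inner_eq_dot, h']
  have ho' : conjSub (ℂ ∙ l) ⟂ conjSub (ℂ ∙ r) := by
    rw [conjSub_span_singleton, conjSub_span_singleton, Submodule.isOrtho_span]
    rintro _ rfl _ rfl
    rw [inner_eq_dot, conjV_conjV, h1]
  rw [simpleFactor_eq_of_isIsotropic hiso]
  simp only [conjSub_sup, starProjection_sup_of_isOrtho ho, starProjection_sup_of_isOrtho ho']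
  ext1 x
  simp only [mul_apply_eq_comp, hl.simpleFactor_span, hr.simpleFactor_span, add_apply, smul_apply,
    one_apply_eq_self, hl.starProjection_span, hr.starProjection_span,
    hl.starProjection_conjSub_span, hr.starProjection_conjSub_span]
  simp only [flow, dot_add_right, dot_smul_right, h, h', h1, h2]
  module

/-- The line completing the two lines of a pair to coassociative planes. -/
theorem exists_completing_line (hl : NullPair l (conjV l)) (hk : NullPair k (conjV k))
    (hp : PairCondition (ℂ ∙ l) (ℂ ∙ k)) (α : ℂ) :
    ∃ R : Submodule ℂ V, IsIsotropicLine R ∧ IsCoassociative ((ℂ ∙ l) ⊔ R) ∧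
      IsCoassociative (conjSub R ⊔ (ℂ ∙ k)) ∧
      ∀ z ∈ ({α, starRingEnd ℂ α}ᶜ : Set ℂ), simpleFactor α (ℂ ∙ l) z * simpleFactor α (ℂ ∙ k) z =
        simpleFactor α ((ℂ ∙ l) ⊔ R) z * simpleFactor α (conjSub R ⊔ (ℂ ∙ k)) z := by
  have h0 := span_le_perp_conjSub.mp hp.1
  obtain ⟨hne, hw⟩ := (hl.pairCondition_iff hk).mp hp
  set m := conjV k with hm
  have h0' : dot l m = 0 := by rw [← conjV_conjV l, dot_conjV_conjV, h0, map_zero]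
  have hmm : dot m m = 0 := hk.right
  -- The vector l · k̄ is annihilated by both l and k̄, by the alternative law.
  set r₀ := imMul l m with hr₀
  have hlr₀ : imMul l r₀ = 0 := by rw [hr₀, imMul_imMul_self, h0', hl.left]; simp
  have hmr₀ : imMul m r₀ = 0 := by
    rw [hr₀, imMul_anticomm l m, imMul_neg_right, imMul_imMul_self, dot_comm, h0', hmm]; simp
  have hr₀0 : r₀ ≠ 0 := by
    intro h
    -- If l · k̄ = 0, expanding l · (l̄ · k̄) shows that k̄ lies in L, contrary to K ≠ L̄.
    have e := imMul_imMul_polarized (conjV l) l m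
    have hmw : imMul m (imMul l (conjV l)) = m := by rw [hw]; exact hk.symm.mul_cross_left
    rw [← hr₀, h, imMul_zero_right, imMul_anticomm (conjV l) m,
      imMul_eigen_opposite hmw hl.mul_cross_right, imMul_neg_right, imMul_smul_right,
      hl.mul_cross_left, h0', hl.pairing', dot_comm m (conjV l)] at e
    have e2 : m = dot (conjV l) m • l := by
      linear_combination (norm := module) (1 / 2 : ℂ) • e
    apply hne
    have e3 : k = starRingEnd ℂ (dot (conjV l) m) • conjV l := by
      rw [← conjV_smul, ← e2, hm, conjV_conjV]
    have hc : starRingEnd ℂ (dot (conjV l) m) ≠ 0 := fun hc => hk.ne_zero (by rw [e3, hc, zero_smul])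
    rw [e3, conjSub_span_singleton]
    exact Submodule.span_singleton_smul_eq hc.isUnit _
  have hr₀r₀ : dot r₀ r₀ = 0 := by
    conv_lhs => rw [hr₀, dot_imMul, ← hr₀, hmr₀, dot_zero_right]
  obtain ⟨r, hr, hspan⟩ := IsIsotropicLine.exists_eq_span (L := ℂ ∙ r₀)
    ⟨finrank_span_singleton hr₀0, by
      intro x hx y hy
      obtain ⟨a, rfl⟩ := Submodule.mem_span_singleton.mp hx
      obtain ⟨b, rfl⟩ := Submodule.mem_span_singleton.mp hy
      simp [hr₀r₀]⟩
  obtain ⟨t, rfl⟩ := Submodule.mem_span_singleton.mp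
    (hspan ▸ Submodule.mem_span_singleton_self r)
  set r := t • r₀ with hrdef
  have lr : dot l r = 0 := by rw [hrdef, dot_smul_right, hr₀, dot_cross_left, mul_zero]
  have l'r : dot (conjV l) r = 0 := by
    rw [hrdef, dot_smul_right, hr₀, ← dot_imMul, imMul_anticomm, hw, dot_neg_left,
      dot_comm, dot_cross_left, neg_zero, mul_zero]
  have mr : dot m r = 0 := by rw [hrdef, dot_smul_right, hr₀, dot_cross_right, mul_zero]
  have kr : dot k r = 0 := by
    rw [hrdef, dot_smul_right, hr₀, dot_comm, dot_imMul, ← hw, dot_cross_left, mul_zero]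
  have ilr : imMul l r = 0 := by rw [hrdef, imMul_smul_right, hlr₀, smul_zero]
  have imr : imMul m r = 0 := by rw [hrdef, imMul_smul_right, hmr₀, smul_zero]
  have r'k : dot (conjV r) k = 0 := by
    rw [← conjV_conjV k, dot_conjV_conjV, ← hm, dot_comm, mr, map_zero]
  have ir'k : imMul (conjV r) k = 0 := by
    rw [← conjV_conjV k, imMul_conjV_conjV, ← hm, imMul_anticomm, imr, neg_zero, conjV_zero]
  refine ⟨ℂ ∙ r, hr.isIsotropicLine_span,
    isCoassociative_span_sup hl.ne_zero hr.ne_zero hl.left hr.left lr l'r ilr, ?_, fun z hz => ?_⟩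
  · rw [conjSub_span_singleton]
    exact isCoassociative_span_sup hr.conj.ne_zero hk.ne_zero hr.right hk.left r'k
      (by rw [conjV_conjV, dot_comm, kr]) ir'k
  -- Each plane factor splits into line factors, and the two inner ones, for R and R̄, cancel.
  · rw [hl.simpleFactor_sup hr lr l'r, conjSub_span_singleton,
      hr.conj.simpleFactor_sup hk r'k (by rw [conjV_conjV, dot_comm, kr]),
      ← conjSub_span_singleton, mul_assoc, ← mul_assoc (simpleFactor α (ℂ ∙ r) z),
      hr.simpleFactor_mul_conjSub hz, one_mul]

end NullPair

end G2Loop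

end

/-! ### Assembly of the three statements -/

theorem mainTheorem7 (α : ℂ) (hα : α.im ≠ 0) :
    (∀ L K : Submodule ℂ G2Loop.V, G2Loop.IsIsotropicLine L → G2Loop.IsIsotropicLine K →
      K ≠ G2Loop.conjSub L →
      (G2Loop.PairCondition L K ↔
        G2Loop.IsNegRealG2Loop
          (fun z => G2Loop.simpleFactor α L z * G2Loop.simpleFactor α K z))) ∧
    (∀ L K : Submodule ℂ G2Loop.V, G2Loop.IsIsotropicLine L → G2Loop.IsIsotropicLine K →
      G2Loop.PairCondition L K →
      G2Loop.OnlySimplePoles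
        (fun z => G2Loop.simpleFactor α L z * G2Loop.simpleFactor α K z) α) ∧
    (∀ g : ℂ → G2Loop.V →L[ℂ] G2Loop.V,
      G2Loop.IsNegRealG2Loop g → G2Loop.OnlySimplePoles g α →
      (∃ L K : Submodule ℂ G2Loop.V, G2Loop.IsIsotropicLine L ∧ G2Loop.IsIsotropicLine K ∧
        G2Loop.PairCondition L K ∧
        G2Loop.LoopEq g
          (fun z => G2Loop.simpleFactor α L z * G2Loop.simpleFactor α K z)) ∧
      (∀ L K : Submodule ℂ G2Loop.V, G2Loop.IsIsotropicLine L → G2Loop.IsIsotropicLine K →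
        G2Loop.LoopEq g
          (fun z => G2Loop.simpleFactor α L z * G2Loop.simpleFactor α K z) →
        (K ≤ G2Loop.perp (L ⊔ G2Loop.conjSub L) →
          G2Loop.pairPlane L K = L ⊔ K ∧ G2Loop.IsCoassociative (L ⊔ K) ∧
          G2Loop.LoopEq g (G2Loop.simpleFactor α (L ⊔ K))) ∧
        (¬ K ≤ G2Loop.perp (L ⊔ G2Loop.conjSub L) →
          ∃ R : Submodule ℂ G2Loop.V, G2Loop.IsIsotropicLine R ∧
            G2Loop.IsCoassociative (L ⊔ R) ∧
            G2Loop.IsCoassociative (G2Loop.conjSub R ⊔ K) ∧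
            G2Loop.LoopEq g
              (fun z => G2Loop.simpleFactor α (L ⊔ R) z *
                G2Loop.simpleFactor α (G2Loop.conjSub R ⊔ K) z)))) := by

  open G2Loop in
  refine ⟨fun L K hL hK hne => ⟨fun hp => ?_, fun hg => ?_⟩, fun L K hL hK hp => ?_,
    fun g hg hpoles => ⟨?_, fun L K hL hK hgLK => ?_⟩⟩
  · obtain ⟨l, hl, rfl⟩ := hL.exists_eq_span
    obtain ⟨k, hk, rfl⟩ := hK.exists_eq_span
    exact hl.isNegRealG2Loop hk hp
  · obtain ⟨l, hl, rfl⟩ := hL.exists_eq_span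
    obtain ⟨k, hk, rfl⟩ := hK.exists_eq_span
    obtain ⟨U, -, hU, -, hG⟩ := hg.groupValued
    exact (hl.pairCondition_iff hk).mpr ⟨hne, hl.cross_eq_of_inG2 hα hk hU hG⟩
  · obtain ⟨l, hl, rfl⟩ := hL.exists_eq_span
    obtain ⟨k, hk, rfl⟩ := hK.exists_eq_span
    exact hl.onlySimplePoles hα hk hp
  · obtain ⟨L, K, hL, hK, h⟩ := exists_factorization hα hg hpoles
    exact ⟨L, K, hL, hK, pairCondition_of_loopEq hα hg hpoles hL hK h, h⟩
  · have hp := pairCondition_of_loopEq hα hg hpoles hL hK hgLK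
    obtain ⟨l, hl, rfl⟩ := hL.exists_eq_span
    obtain ⟨k, hk, rfl⟩ := hK.exists_eq_span
    refine ⟨fun hperp => ?_, fun _ => ?_⟩
    · obtain ⟨h1, h2⟩ := NullPair.span_le_perp_sup.mp hperp
      have hplane : pairPlane (ℂ ∙ l) (ℂ ∙ k) = (ℂ ∙ l) ⊔ (ℂ ∙ k) := by
        rw [hl.pairPlane_span, h1, h2, zero_smul, zero_smul, sub_zero, sub_zero]
      refine ⟨hplane, hplane ▸ hp.2, hgLK.trans_of_eq (α := α) fun z _ => ?_⟩
      exact (hl.simpleFactor_sup hk h1 h2 α z).symm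
    · obtain ⟨R, hR, h1, h2, h3⟩ := hl.exists_completing_line hk hp α
      exact ⟨R, hR, h1, h2, hgLK.trans_of_eq h3⟩
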